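/- **Theorem.** Let $n \ge 0$ be an integer. Let $\mathfrak{B}_n$ be the moduli scheme of based commutative algebras of rank $n$: the affine $\mathbb{Z}$-scheme whose $T$-points, for a scheme $T$, are the isomorphism classes of pairs $(\mathcal{A},\phi)$ of a commutative (associative, unital) $\mathcal{O}_T$-algebra $\mathcal{A}$ and an $\mathcal{O}_T$-module isomorphism $\phi : \mathcal{A} \to \mathcal{O}_T^{\oplus n}$; explicitly, it is the closed subscheme of $\mathbb{A}^{n^3+n}_{\mathbb{Z}}$ of structure constants $c_{ij}^{\ell}$ and unit coordinates $d_i$ cut out by commutativity, associativity and unitality. The group scheme $\mathrm{GL}_n$ acts on $\mathfrak{B}_n$ by $M\cdot(\mathcal{A},\phi) = (\mathcal{A}, M\circ\phi)$. Let $\Delta = \det(\mathrm{Tr}(b_i b_j))$ be the discriminant of the trace form, where $b_i=\phi^{-1}(e_i)$, and let $\mathfrak{B}_n^{\mathrm{et}} \subseteq \mathfrak{B}_n$ be the étale locus, i.e. the ($\mathrm{GL}_n$-invariant) open subscheme where $\Delta$ is invertible. Let $S_n$ be the constant group scheme over $\mathbb{Z}$ of the symmetric group, embedded in $\mathrm{GL}_n$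 as the permutation matrices, and let $\mathrm{GL}_n/S_n$ be the homogeneous space, i.e. the scheme (with its left $\mathrm{GL}_n$-action and its quotient morphism from $\mathrm{GL}_n$) that represents the quotient, as a sheaf for the étale topology, of $\mathrm{GL}_n$ by right multiplication by $S_n$. Then: 1. The homogeneous space $\mathrm{GL}_n/S_n$ exists and is $\mathrm{GL}_n$-equivariantly isomorphic to $\mathfrak{B}_n^{\mathrm{et}}$. More precisely, $\mathfrak{B}_n^{\mathrm{et}}$, with the morphism $\mathrm{GL}_n \to \mathfrak{B}_n^{\mathrm{et}}$, $M \mapsto M\cdot \tilde{\mathcal{A}}_{\mathrm{split}}$ (where $\tilde{\mathcal{A}}_{\mathrm{split}}$ is $\mathcal{O}\times\cdots\times\mathcal{O}$ with its obvious basis), is a homogeneous space $\mathrm{GL}_n/S_n$, and every homogeneous space $\mathrm{GL}_n/S_n$ is isomorphic to it by a $\mathrm{GL}_n$-equivariant isomorphism compatible with the morphisms from $\mathrm{GL}_n$. 2. The scheme $\mathfrak{B}_n^{\mathrm{et}}$ is irreducible, and its Zariski closure in $\mathfrak{B}_n$ is an irreducible component of $\mathfrak{B}_n$. 3. For every field $k$,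 the fiber $\mathfrak{B}_{n,k}^{\mathrm{et}}$ is irreducible of dimension $n^2$, and its Zariski closure in $\mathfrak{B}_{n,k} = \mathfrak{B}_n \times_{\operatorname{Spec}\mathbb{Z}} \operatorname{Spec} k$ is an irreducible component of $\mathfrak{B}_{n,k}$ of dimension $n^2$. -/

import Mathlib

open CategoryTheory AlgebraicGeometry Opposite
open scoped TensorProduct Matrix

universe u v

namespace BasedAlgebras

noncomputable section

/-! ### Based algebras of rank `n` -/

/-- A based commutative algebra of rank `n` over the ring `R`, i.e. a pair `(A, φ)` of a commutative
`R`-algebra `A` and an `R`-linear isomorphism `φ : A ≅ R ^ n`, up to isomorphism of pairs.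
Transporting the multiplication along `φ`, this is the same as a commutative associative unital
multiplication `e_i e_j = ∑ l, c i j l e_l` on `R ^ n`, with unit `∑ i, d i e_i`. -/
@[ext]
structure BasedAlg (n : ℕ) (R : Type u) [CommRing R] where
  c : Fin n → Fin n → Fin n → R
  d : Fin n → R
  comm : ∀ i j l, c i j l = c j i l
  assoc : ∀ i j k l, ∑ m, c i j m * c m k l = ∑ m, c j k m * c i m l
  one_mul : ∀ j l, ∑ i, d i * c i j l = if j = l then 1 else 0

namespace BasedAlg

variable {n : ℕ} {R : Type u} {S : Type v} [CommRing R] [CommRing S]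

/-- The standard basis vector `e_i` of `R ^ n`. -/
def e (n : ℕ) (R : Type u) [CommRing R] (i : Fin n) : Fin n → R := Pi.single i 1

/-- The multiplication on `R ^ n` of a based algebra. -/
def mul (A : BasedAlg n R) : (Fin n → R) →ₗ[R] (Fin n → R) →ₗ[R] (Fin n → R) :=
  LinearMap.mk₂ R (fun x y l => ∑ i, ∑ j, x i * y j * A.c i j l)
    (fun x x' y => by
      ext l; simp [add_mul, Finset.sum_add_distrib])
    (fun a x y => by
      ext l; simp [Finset.mul_sum, mul_assoc])
    (fun x y y' => by
      ext l; simp [mul_add, add_mul, Finset.sum_add_distrib])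
    (fun a x y => by
      ext l; simp only [Pi.smul_apply, smul_eq_mul, Finset.mul_sum]
      refine Finset.sum_congr rfl fun i _ => Finset.sum_congr rfl fun j _ => ?_
      ring)

lemma mul_apply (A : BasedAlg n R) (x y : Fin n → R) (l : Fin n) :
    A.mul x y l = ∑ i, ∑ j, x i * y j * A.c i j l := rfl

lemma mul_e (A : BasedAlg n R) (i j : Fin n) : A.mul (e n R i) (e n R j) = A.c i j := by
  ext l
  simp [mul_apply, e, Pi.single_apply]

lemma mul_comm' (A : BasedAlg n R) (x y : Fin n → R) : A.mul x y = A.mul y x := by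
  ext l
  rw [mul_apply, mul_apply, Finset.sum_comm]
  refine Finset.sum_congr rfl fun i _ => Finset.sum_congr rfl fun j _ => ?_
  rw [A.comm j i l]; ring

lemma ext_of_e {M : Type*} [AddCommMonoid M] [Module R M] {f g : (Fin n → R) →ₗ[R] M}
    (h : ∀ i, f (e n R i) = g (e n R i)) : f = g :=
  (Pi.basisFun R (Fin n)).ext fun i => by simpa [e] using h i

lemma mul_e_left (A : BasedAlg n R) (j : Fin n) (y : Fin n → R) (l : Fin n) :
    A.mul (e n R j) y l = ∑ m, y m * A.c j m l := by
  simp [mul_apply, e, Pi.single_apply]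

lemma mul_e_right (A : BasedAlg n R) (j : Fin n) (x : Fin n → R) (l : Fin n) :
    A.mul x (e n R j) l = ∑ m, x m * A.c m j l := by
  simp [mul_apply, e, Pi.single_apply]

lemma mul_assoc' (A : BasedAlg n R) (x y z : Fin n → R) :
    A.mul (A.mul x y) z = A.mul x (A.mul y z) := by
  let f : (Fin n → R) →ₗ[R] (Fin n → R) →ₗ[R] (Fin n → R) →ₗ[R] (Fin n → R) := A.mul.compr₂ A.mul
  let g : (Fin n → R) →ₗ[R] (Fin n → R) →ₗ[R] (Fin n → R) →ₗ[R] (Fin n → R) :=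
    (LinearMap.lcomp R ((Fin n → R) →ₗ[R] (Fin n → R)) A.mul) ∘ₗ
      (LinearMap.llcomp R (Fin n → R) (Fin n → R) (Fin n → R)) ∘ₗ A.mul
  have hfg : f = g := by
    refine ext_of_e fun i => ext_of_e fun j => ext_of_e fun k => ?_
    ext l
    simp only [f, g, LinearMap.compr₂_apply, LinearMap.comp_apply, LinearMap.lcomp_apply,
      LinearMap.llcomp_apply, mul_e, mul_e_left, mul_e_right]
    exact A.assoc i j k l
  exact congrArg (fun h => h x y z) hfg

lemma one_mul' (A : BasedAlg n R) (y : Fin n → R) : A.mul A.d y = y := by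
  have : A.mul A.d = LinearMap.id := by
    refine ext_of_e fun j => ?_
    ext l
    rw [mul_e_right, A.one_mul]
    simp [e, Pi.single_apply, eq_comm]
  rw [this]; rfl

/-- The based algebra with a given multiplication and unit on `R ^ n`. -/
def ofMul (μ : (Fin n → R) →ₗ[R] (Fin n → R) →ₗ[R] (Fin n → R)) (d : Fin n → R)
    (comm : ∀ x y, μ x y = μ y x) (assoc : ∀ x y z, μ (μ x y) z = μ x (μ y z))
    (one_mul : ∀ x, μ d x = x) : BasedAlg n R where
  c i j l := μ (e n R i) (e n R j) l
  d := d
  comm i j l := by rw [comm]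
  assoc i j k l := by
    have key : ∀ v : Fin n → R, v = ∑ m, v m • e n R m := fun v => by
      ext l; simp [e, Pi.single_apply]
    have h := congrFun (assoc (e n R i) (e n R j) (e n R k)) l
    rw [key (μ (e n R i) (e n R j)), key (μ (e n R j) (e n R k))] at h
    simpa using h
  one_mul j l := by
    have key : ∀ v : Fin n → R, v = ∑ m, v m • e n R m := fun v => by
      ext l; simp [e, Pi.single_apply]
    have h := congrFun (one_mul (e n R j)) l
    rw [key d] at h
    simpa [e, Pi.single_apply, eq_comm] using h

lemma mul_ofMul (μ : (Fin n → R) →ₗ[R] (Fin n → R) →ₗ[R] (Fin n → R)) (d : Fin n → R)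
    (comm : ∀ x y, μ x y = μ y x) (assoc : ∀ x y z, μ (μ x y) z = μ x (μ y z))
    (one_mul : ∀ x, μ d x = x) : (ofMul μ d comm assoc one_mul).mul = μ :=
  ext_of_e fun i => ext_of_e fun j => by rw [mul_e]; rfl

lemma ext_mul {A B : BasedAlg n R} (h : A.mul = B.mul) (hd : A.d = B.d) : A = B := by
  refine BasedAlg.ext ?_ hd
  funext i j
  rw [← mul_e, ← mul_e, h]

/-- The based algebra given by a commutative algebra `A` and an isomorphism `φ : A ≅ R ^ n`. -/
def ofEquiv {A : Type v} [CommRing A] [Algebra R A] (φ : A ≃ₗ[R] (Fin n → R)) : BasedAlg n R :=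
  ofMul (((LinearMap.mul R A).compl₁₂ φ.symm.toLinearMap φ.symm.toLinearMap).compr₂
      φ.toLinearMap) (φ 1)
    (fun x y => by simp [mul_comm]) (fun x y z => by simp [mul_assoc]) (fun x => by simp)

/-- The split algebra `R × ⋯ × R` with its obvious basis. -/
def split (n : ℕ) (R : Type u) [CommRing R] : BasedAlg n R :=
  ofEquiv (LinearEquiv.refl R (Fin n → R))

/-- Base change along a ring homomorphism. -/
def map (f : R →+* S) (A : BasedAlg n R) : BasedAlg n S where
  c i j l := f (A.c i j l)
  d i := f (A.d i)
  comm i j l := by rw [A.comm]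
  assoc i j k l := by simpa using congrArg f (A.assoc i j k l)
  one_mul j l := by simpa [apply_ite f] using congrArg f (A.one_mul j l)

lemma mul_map (f : R →+* S) (A : BasedAlg n R) (x y : Fin n → R) :
    (A.map f).mul (f ∘ x) (f ∘ y) = f ∘ A.mul x y := by
  ext l
  simp [mul_apply, map]

/-- `GL_n(R)` acts on based algebras: `M` sends `(A, φ)` to `(A, M ∘ φ)`. -/
def smul (M : GL (Fin n) R) (A : BasedAlg n R) : BasedAlg n R :=
  ofMul ((A.mul.compl₁₂ (Matrix.toLin' (M⁻¹ : GL (Fin n) R).1)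
      (Matrix.toLin' (M⁻¹ : GL (Fin n) R).1)).compr₂ (Matrix.toLin' M.1)) (M.1 *ᵥ A.d)
    (fun x y => by simp [A.mul_comm' (_ *ᵥ x)])
    (fun x y z => by simp [A.mul_assoc'])
    (fun x => by simp [A.one_mul'])

lemma smul_mul (M : GL (Fin n) R) (A : BasedAlg n R) (x y : Fin n → R) :
    (A.smul M).mul x y =
      M.1 *ᵥ A.mul ((M⁻¹ : GL (Fin n) R).1 *ᵥ x) ((M⁻¹ : GL (Fin n) R).1 *ᵥ y) := by
  rw [smul, mul_ofMul]
  simp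

lemma smul_ofEquiv {A : Type v} [CommRing A] [Algebra R A] (φ : A ≃ₗ[R] (Fin n → R))
    (M : GL (Fin n) R) :
    (ofEquiv φ).smul M = ofEquiv (φ.trans (Matrix.GeneralLinearGroup.toLin M).toLinearEquiv) := by
  refine ext_mul ?_ ?_
  · refine LinearMap.ext₂ fun x y => ?_
    rw [smul_mul, ofEquiv, ofEquiv, mul_ofMul, mul_ofMul]
    have h : ∀ z, (Matrix.GeneralLinearGroup.toLin M).toLinearEquiv.symm z =
        (M⁻¹ : GL (Fin n) R).1 *ᵥ z := fun z => rfl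
    have h' : ∀ z, (Matrix.GeneralLinearGroup.toLin M).toLinearEquiv z = M.1 *ᵥ z := fun z => rfl
    simp only [LinearMap.compr₂_apply, LinearMap.compl₁₂_apply, LinearEquiv.coe_coe,
      LinearEquiv.trans_symm, LinearEquiv.trans_apply, h, h']
  · rfl

lemma one_smul (A : BasedAlg n R) : A.smul 1 = A := by
  refine ext_mul ?_ ?_
  · refine LinearMap.ext₂ fun x y => ?_
    rw [smul_mul]; simp
  · simp [smul, ofMul]

lemma mul_smul (M N : GL (Fin n) R) (A : BasedAlg n R) :
    A.smul (M * N) = (A.smul N).smul M := by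
  refine ext_mul ?_ ?_
  · refine LinearMap.ext₂ fun x y => ?_
    simp only [smul_mul, mul_inv_rev, Units.val_mul, Matrix.mulVec_mulVec]
  · simp [smul, ofMul]

lemma map_smul (f : R →+* S) (M : GL (Fin n) R) (A : BasedAlg n R) :
    (A.smul M).map f = (A.map f).smul (Matrix.GeneralLinearGroup.map f M) := by
  have hv : ∀ (P : Matrix (Fin n) (Fin n) R) (x : Fin n → R),
      f ∘ (P *ᵥ x) = P.map f *ᵥ (f ∘ x) := fun P x => by
    ext i; simp [Matrix.mulVec, dotProduct]
  have he : ∀ i, f ∘ e n R i = e n S i := fun i => by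
    ext j; simp [e, Pi.single_apply, apply_ite f]
  refine ext_mul ?_ ?_
  · refine ext_of_e fun i => ext_of_e fun j => ?_
    rw [← he, ← he, mul_map, smul_mul, smul_mul, hv, ← mul_map, hv, hv, ← map_inv]
    rfl
  · exact hv _ _

/-- The discriminant `det (Tr (b_i b_j))` of the trace form, where `Tr x` is the trace of the
multiplication by `x`. -/
def disc (A : BasedAlg n R) : R :=
  Matrix.det (Matrix.of fun i j =>
    LinearMap.trace R (Fin n → R) (A.mul (A.mul (e n R i) (e n R j))))

lemma trace_mul (A : BasedAlg n R) (x : Fin n → R) :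
    LinearMap.trace R (Fin n → R) (A.mul x) = ∑ i, ∑ j, x i * A.c i j j := by
  rw [LinearMap.trace_eq_matrix_trace R (Pi.basisFun R (Fin n)), Matrix.trace, Finset.sum_comm]
  refine Finset.sum_congr rfl fun j _ => ?_
  rw [Matrix.diag_apply, LinearMap.toMatrix_apply, Pi.basisFun_apply, Pi.basisFun_repr]
  exact mul_e_right A j x j

lemma disc_map (f : R →+* S) (A : BasedAlg n R) : (A.map f).disc = f A.disc := by
  rw [disc, disc, RingHom.map_det]
  congr 1
  ext i j
  simp [trace_mul, mul_e, map]

lemma disc_smul (M : GL (Fin n) R) (A : BasedAlg n R) :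
    (A.smul M).disc = ((M⁻¹ : GL (Fin n) R).1.det) ^ 2 * A.disc := by
  set N : Matrix (Fin n) (Fin n) R := (M⁻¹ : GL (Fin n) R).1 with hN
  set G : Matrix (Fin n) (Fin n) R := Matrix.of fun i j =>
    LinearMap.trace R (Fin n → R) (A.mul (A.mul (e n R i) (e n R j))) with hG
  have hNM : ∀ x : Fin n → R, N *ᵥ (M.1 *ᵥ x) = x := fun x => by
    rw [Matrix.mulVec_mulVec, hN, ← Units.val_mul, inv_mul_cancel]; simp
  have htr : ∀ x, LinearMap.trace R (Fin n → R) ((A.smul M).mul x) =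
      LinearMap.trace R (Fin n → R) (A.mul (N *ᵥ x)) := fun x => by
    have : (A.smul M).mul x = (Matrix.toLin' M.1 * A.mul (N *ᵥ x)) * Matrix.toLin' N := by
      refine LinearMap.ext fun y => ?_
      rw [smul_mul]; simp [hN]
    rw [this, LinearMap.trace_mul_comm, ← mul_assoc]
    congr 1
    refine LinearMap.ext fun y => ?_
    simp [hNM]
  have hNe : ∀ i, N *ᵥ e n R i = ∑ a, N a i • e n R a := fun i => by
    ext l; simp [e, Pi.single_apply]
  have hmat : (Matrix.of fun i j => LinearMap.trace R (Fin n → R)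
      ((A.smul M).mul ((A.smul M).mul (e n R i) (e n R j)))) = Nᵀ * G * N := by
    ext i j
    rw [Matrix.of_apply, htr, smul_mul, ← hN, hNM, hNe, hNe]
    simp only [map_sum, _root_.map_smul, LinearMap.sum_apply, LinearMap.smul_apply, smul_eq_mul,
      Matrix.mul_apply, Matrix.transpose_apply, hG, Matrix.of_apply, Finset.mul_sum,
      Finset.sum_mul]
    refine Finset.sum_congr rfl fun a _ => Finset.sum_congr rfl fun b _ => ?_
    ring
  rw [disc, hmat, Matrix.det_mul, Matrix.det_mul, Matrix.det_transpose, disc]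
  ring

lemma disc_split : (split n R).disc = 1 := by
  have hs : ∀ x y : Fin n → R, (split n R).mul x y = x * y := fun x y => by
    rw [split, ofEquiv, mul_ofMul]; rfl
  have h : (Matrix.of fun i j => LinearMap.trace R (Fin n → R)
      ((split n R).mul ((split n R).mul (e n R i) (e n R j)))) = 1 := by
    ext i j
    rw [Matrix.of_apply, trace_mul]
    simp only [← mul_e, hs]
    simp [e, Pi.single_apply, Matrix.one_apply, eq_comm]
  rw [disc, h, Matrix.det_one]

end BasedAlg

/-! ### The moduli scheme -/

/-- The coordinates on the affine space of dimension `n ^ 3 + n`: `c i j l` and `d i`. -/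
abbrev Coord (n : ℕ) : Type := (Fin n × Fin n × Fin n) ⊕ Fin n

/-- The coordinate function `c i j l`. -/
def xc (n : ℕ) (i j l : Fin n) : MvPolynomial (Coord n) ℤ := MvPolynomial.X (Sum.inl (i, j, l))

/-- The coordinate function `d i`. -/
def xd (n : ℕ) (i : Fin n) : MvPolynomial (Coord n) ℤ := MvPolynomial.X (Sum.inr i)

/-- The ideal generated by the polynomial conditions of commutativity, associativity and unitality.
-/
def relIdeal (n : ℕ) : Ideal (MvPolynomial (Coord n) ℤ) :=
  Ideal.span {p | (∃ i j l, p = xc n i j l - xc n j i l) ∨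
    (∃ i j k l, p = ∑ m, xc n i j m * xc n m k l - ∑ m, xc n j k m * xc n i m l) ∨
    (∃ j l, p = ∑ i, xd n i * xc n i j l - if j = l then 1 else 0)}

/-- The coordinate ring of the moduli scheme of based algebras of rank `n`. -/
abbrev CoordRing (n : ℕ) : Type := MvPolynomial (Coord n) ℤ ⧸ relIdeal n

/-- The universal based algebra. -/
def univAlg (n : ℕ) : BasedAlg n (CoordRing n) where
  c i j l := Ideal.Quotient.mk _ (xc n i j l)
  d i := Ideal.Quotient.mk _ (xd n i)
  comm i j l := by
    rw [← sub_eq_zero, ← map_sub, Ideal.Quotient.eq_zero_iff_mem]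
    exact Ideal.subset_span (Or.inl ⟨i, j, l, rfl⟩)
  assoc i j k l := by
    rw [← sub_eq_zero]
    simp only [← map_mul, ← map_sum, ← map_sub]
    rw [Ideal.Quotient.eq_zero_iff_mem]
    exact Ideal.subset_span (Or.inr (Or.inl ⟨i, j, k, l, rfl⟩))
  one_mul j l := by
    have h : (if j = l then 1 else 0 : CoordRing n) =
        Ideal.Quotient.mk (relIdeal n) (if j = l then 1 else 0) := by
      split_ifs <;> simp
    rw [← sub_eq_zero, h]
    simp only [← map_mul, ← map_sum, ← map_sub]
    rw [Ideal.Quotient.eq_zero_iff_mem]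
    exact Ideal.subset_span (Or.inr (Or.inr ⟨j, l, rfl⟩))

/-- The ring homomorphism classifying a based algebra. -/
def algHom {n : ℕ} {R : Type u} [CommRing R] (A : BasedAlg n R) : CoordRing n →+* R :=
  Ideal.Quotient.lift (relIdeal n)
    (MvPolynomial.eval₂Hom (Int.castRingHom R) (Sum.elim (fun t => A.c t.1 t.2.1 t.2.2) A.d)) (by
      suffices h : relIdeal n ≤ RingHom.ker (MvPolynomial.eval₂Hom (Int.castRingHom R)
          (Sum.elim (fun t => A.c t.1 t.2.1 t.2.2) A.d)) from fun a ha => h ha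
      refine Ideal.span_le.2 ?_
      rintro p (⟨i, j, l, rfl⟩ | ⟨i, j, k, l, rfl⟩ | ⟨j, l, rfl⟩)
      · simp [xc, RingHom.mem_ker, A.comm i j l]
      · simp [xc, RingHom.mem_ker, A.assoc i j k l]
      · have := A.one_mul j l
        simp only [SetLike.mem_coe, RingHom.mem_ker, map_sub, map_sum, map_mul, xc, xd,
          MvPolynomial.coe_eval₂Hom, MvPolynomial.eval₂_X, Sum.elim_inl, Sum.elim_inr, this]
        split_ifs <;> simp)

lemma univAlg_map_algHom {n : ℕ} {R : Type u} [CommRing R] (A : BasedAlg n R) :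
    (univAlg n).map (algHom A) = A := by
  refine BasedAlg.ext ?_ ?_
  · funext i j l
    exact (Ideal.Quotient.lift_mk _ _ _).trans (by simp [xc])
  · funext i
    exact (Ideal.Quotient.lift_mk _ _ _).trans (by simp [xd])

lemma algHom_univAlg_map {n : ℕ} {R : Type u} [CommRing R] (f : CoordRing n →+* R) :
    algHom ((univAlg n).map f) = f := by
  refine Ideal.Quotient.ringHom_ext (MvPolynomial.ringHom_ext (fun r => by simp) ?_)
  rintro (⟨i, j, l⟩ | i) <;> simp [univAlg, algHom, BasedAlg.map, xc, xd]

/-- The moduli scheme `𝔅_n` of based commutative algebras of rank `n`. -/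
def moduli (n : ℕ) : Scheme.{0} := Spec (.of (CoordRing n))

/-- Morphisms from a scheme `T` to `Spec R` are ring homomorphisms `R → Γ(T)`. -/
def homSpecEquiv (R : CommRingCat.{u}) (T : Scheme.{u}) : (T ⟶ Spec R) ≃ (R →+* Γ(T, ⊤)) where
  toFun f := ((Scheme.ΓSpecIso R).inv ≫ f.appTop).hom
  invFun φ := T.toSpecΓ ≫ Spec.map (CommRingCat.ofHom φ)
  left_inv f := by
    change T.toSpecΓ ≫ Spec.map ((Scheme.ΓSpecIso R).inv ≫ f.appTop) = f
    rw [Spec.map_comp, ← Scheme.toSpecΓ_naturality_assoc, toSpecΓ_SpecMap_ΓSpecIso_inv,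
      Category.comp_id]
  right_inv φ := by
    have h : (Scheme.ΓSpecIso R).inv ≫ (T.toSpecΓ ≫ Spec.map (CommRingCat.ofHom φ)).appTop =
        CommRingCat.ofHom φ := by
      rw [Scheme.Hom.comp_appTop, Scheme.toSpecΓ_appTop, Scheme.ΓSpecIso_naturality]
      exact Iso.inv_hom_id_assoc (Scheme.ΓSpecIso R) _
    exact congrArg CommRingCat.Hom.hom h

lemma homSpecEquiv_comp {R : CommRingCat.{u}} {T T' : Scheme.{u}} (f : T' ⟶ T) (g : T ⟶ Spec R) :
    homSpecEquiv R T' (f ≫ g) = f.appTop.hom.comp (homSpecEquiv R T g) := by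
  simp [homSpecEquiv]
  rfl

/-- The functor sending a scheme `T` to the set of based algebras of rank `n` over `T`
(algebra structures on `𝒪_T ^ n`, which are given by constants `c i j l` and `d i` in `Γ(T)`). -/
def algFunctor (n : ℕ) : Scheme.{0}ᵒᵖ ⥤ Type where
  obj T := BasedAlg n Γ(T.unop, ⊤)
  map f := ↾ fun A => A.map f.unop.appTop.hom

/-- The scheme `𝔅_n` represents the functor of based algebras. -/
def moduliRep (n : ℕ) : (algFunctor n).RepresentableBy (moduli n) where
  homEquiv {T} := (homSpecEquiv (.of (CoordRing n)) T).trans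
    { toFun := fun f => (univAlg n).map f
      invFun := algHom
      left_inv := algHom_univAlg_map
      right_inv := univAlg_map_algHom }
  homEquiv_comp f g := by
    simp
    rfl

/-- The based algebra over `T` corresponding to a `T`-point of `𝔅_n`. -/
def toAlg {n : ℕ} {T : Scheme.{0}} (x : T ⟶ moduli n) : BasedAlg n Γ(T, ⊤) :=
  (moduliRep n).homEquiv x

/-- The `T`-point of `𝔅_n` corresponding to a based algebra over `T`. -/
def ofAlg {n : ℕ} {T : Scheme.{0}} (A : BasedAlg n Γ(T, ⊤)) : T ⟶ moduli n :=
  (moduliRep n).homEquiv.symm A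

@[simp] lemma toAlg_ofAlg {n : ℕ} {T : Scheme.{0}} (A : BasedAlg n Γ(T, ⊤)) :
    toAlg (ofAlg A) = A := Equiv.apply_symm_apply _ _

@[simp] lemma ofAlg_toAlg {n : ℕ} {T : Scheme.{0}} (x : T ⟶ moduli n) :
    ofAlg (toAlg x) = x := Equiv.symm_apply_apply _ _

lemma toAlg_comp {n : ℕ} {T T' : Scheme.{0}} (f : T' ⟶ T) (x : T ⟶ moduli n) :
    toAlg (f ≫ x) = (toAlg x).map f.appTop.hom := (moduliRep n).homEquiv_comp f x

/-- The regular function `Δ` on `𝔅_n`, the discriminant of the trace form. -/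
def discFun (n : ℕ) : CoordRing n := (univAlg n).disc

/-- The étale locus `𝔅_n^et`: the open subscheme of `𝔅_n` where `Δ` is invertible. -/
def etaleLocus (n : ℕ) : (moduli n).Opens := PrimeSpectrum.basicOpen (discFun n)

/-- A `T`-point of `𝔅_n` lies in the étale locus iff its discriminant is invertible. -/
lemma range_subset_etaleLocus_iff {n : ℕ} {T : Scheme.{0}} (x : T ⟶ moduli n) :
    Set.range x ⊆ etaleLocus n ↔ IsUnit (toAlg x).disc := by
  have h1 : x ⁻¹ᵁ etaleLocus n = T.basicOpen (toAlg x).disc := by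
    have h2 : (toAlg x).disc =
        x.appTop ((Scheme.ΓSpecIso (.of (CoordRing n))).inv (discFun n)) :=
      (univAlg n).disc_map (homSpecEquiv (.of (CoordRing n)) T x)
    rw [h2]
    refine Eq.trans ?_ (Scheme.preimage_basicOpen_top x _)
    exact congrArg (x ⁻¹ᵁ ·) (basicOpen_eq_of_affine (R := .of (CoordRing n)) (discFun n)).symm
  have h3 : Set.range x ⊆ etaleLocus n ↔ x ⁻¹ᵁ etaleLocus n = ⊤ := by
    rw [Set.range_subset_iff, eq_top_iff]
    exact ⟨fun h t _ => h t, fun h t => h (Set.mem_univ t)⟩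
  rw [h3, h1]
  refine ⟨fun h => ?_, fun h => T.basicOpen_of_isUnit h⟩
  refine T.toRingedSpace.isUnit_of_isUnit_germ ⊤ _ fun t ht => ?_
  have : t ∈ T.basicOpen (toAlg x).disc := by rw [h]; exact ht
  exact (T.mem_basicOpen _ t ht).1 this

/-! ### The schemes `GL_n` and `S_n` -/

/-- The coordinate ring `ℤ[x_ij, 1 / det]` of `GL_n`. -/
abbrev GLRing (n : ℕ) : Type :=
  Localization.Away (Matrix.mvPolynomialX (Fin n) (Fin n) ℤ).det

/-- The universal invertible matrix. -/
def univGL (n : ℕ) : GL (Fin n) (GLRing n) :=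
  Matrix.GeneralLinearGroup.mk''
    ((Matrix.mvPolynomialX (Fin n) (Fin n) ℤ).map (algebraMap _ (GLRing n))) (by
      have := IsLocalization.Away.algebraMap_isUnit (S := GLRing n)
        (Matrix.mvPolynomialX (Fin n) (Fin n) ℤ).det
      rwa [RingHom.map_det] at this)

lemma isUnit_eval_det {n : ℕ} {R : Type u} [CommRing R] (M : GL (Fin n) R) :
    IsUnit (MvPolynomial.eval₂Hom (Int.castRingHom R) (fun p : Fin n × Fin n => M.1 p.1 p.2)
      (Matrix.mvPolynomialX (Fin n) (Fin n) ℤ).det) := by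
  have h : ((Matrix.mvPolynomialX (Fin n) (Fin n) ℤ).map (MvPolynomial.eval₂Hom
      (Int.castRingHom R) (fun p : Fin n × Fin n => M.1 p.1 p.2))) = M.1 :=
    Matrix.mvPolynomialX_map_eval₂ _ M.1
  rw [RingHom.map_det, RingHom.mapMatrix_apply, h]
  exact (Matrix.isUnit_iff_isUnit_det _).1 M.isUnit

/-- The ring homomorphism classifying an invertible matrix. -/
def glHom {n : ℕ} {R : Type u} [CommRing R] (M : GL (Fin n) R) : GLRing n →+* R :=
  IsLocalization.Away.lift _ (isUnit_eval_det M)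

lemma glHom_X {n : ℕ} {R : Type u} [CommRing R] (M : GL (Fin n) R) (i j : Fin n) :
    glHom M (algebraMap (MvPolynomial (Fin n × Fin n) ℤ) (GLRing n) (MvPolynomial.X (i, j))) = M.1 i j :=
  (IsLocalization.Away.lift_eq _ (isUnit_eval_det M) _).trans (by simp)

lemma map_glHom_univGL {n : ℕ} {R : Type u} [CommRing R] (M : GL (Fin n) R) :
    Matrix.GeneralLinearGroup.map (glHom M) (univGL n) = M := by
  ext i j
  exact glHom_X M i j

lemma glHom_map_univGL {n : ℕ} {R : Type u} [CommRing R] (f : GLRing n →+* R) :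
    glHom (Matrix.GeneralLinearGroup.map f (univGL n)) = f := by
  refine IsLocalization.ringHom_ext
    (Submonoid.powers (Matrix.mvPolynomialX (Fin n) (Fin n) ℤ).det) ?_
  refine MvPolynomial.ringHom_ext (fun r => by simp) fun p => ?_
  exact glHom_X _ p.1 p.2

/-- The general linear group scheme `GL_n` over `ℤ`. -/
def GLScheme (n : ℕ) : Scheme.{0} := Spec (.of (GLRing n))

/-- The functor `T ↦ GL_n(Γ(T))`. -/
def glFunctor (n : ℕ) : Scheme.{0}ᵒᵖ ⥤ Type where
  obj T := GL (Fin n) Γ(T.unop, ⊤)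
  map f := ↾ fun M => Matrix.GeneralLinearGroup.map f.unop.appTop.hom M

/-- The scheme `GL_n` represents the functor `T ↦ GL_n(Γ(T))`. -/
def glRep (n : ℕ) : (glFunctor n).RepresentableBy (GLScheme n) where
  homEquiv {T} := (homSpecEquiv (.of (GLRing n)) T).trans
    { toFun := fun f => Matrix.GeneralLinearGroup.map f (univGL n)
      invFun := glHom
      left_inv := glHom_map_univGL
      right_inv := map_glHom_univGL }
  homEquiv_comp f g := by
    simp
    rfl

/-- The invertible matrix over `T` corresponding to a `T`-point of `GL_n`. -/
def toGL {n : ℕ} {T : Scheme.{0}} (g : T ⟶ GLScheme n) : GL (Fin n) Γ(T, ⊤) :=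
  (glRep n).homEquiv g

/-- The `T`-point of `GL_n` corresponding to an invertible matrix over `T`. -/
def ofGL {n : ℕ} {T : Scheme.{0}} (M : GL (Fin n) Γ(T, ⊤)) : T ⟶ GLScheme n :=
  (glRep n).homEquiv.symm M

/-- The permutation matrix of `σ`, sending `e_j` to `e_(σ j)`. -/
def permMat {n : ℕ} (σ : Equiv.Perm (Fin n)) : Matrix (Fin n) (Fin n) ℤ :=
  Matrix.of fun i j => if i = σ j then 1 else 0

lemma permMat_mul {n : ℕ} (σ τ : Equiv.Perm (Fin n)) :
    permMat σ * permMat τ = permMat (σ * τ) := by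
  ext i j
  simp only [Matrix.mul_apply, permMat, Matrix.of_apply, mul_ite, mul_one, mul_zero,
    Equiv.Perm.mul_apply]
  rw [Finset.sum_ite_eq' Finset.univ (τ j)]
  simp only [Finset.mem_univ, if_true]
  rfl

lemma permMat_one {n : ℕ} : permMat (1 : Equiv.Perm (Fin n)) = 1 := by
  ext i j
  simp only [permMat, Matrix.of_apply, Matrix.one_apply, Equiv.Perm.one_apply]
  rfl

/-- The constant group scheme `S_n` over `ℤ`, as the spectrum of the ring of functions `S_n → ℤ`
(a disjoint union of copies of `Spec ℤ` indexed by the permutations). -/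
def SnScheme (n : ℕ) : Scheme.{0} := Spec (.of (Equiv.Perm (Fin n) → ℤ))

/-- The matrix over the ring of functions `S_n → ℤ` whose value at `σ` is the permutation matrix of
`σ`. -/
def univPerm (n : ℕ) : GL (Fin n) (Equiv.Perm (Fin n) → ℤ) where
  val := Matrix.of fun i j σ => permMat σ i j
  inv := Matrix.of fun i j σ => permMat σ⁻¹ i j
  val_inv := by
    ext i j σ
    have h := congrFun (congrFun (permMat_mul σ σ⁻¹) i) j
    rw [mul_inv_cancel, permMat_one] at h
    simpa [Matrix.mul_apply, Matrix.one_apply, apply_ite (fun f : _ → ℤ => f σ)] using h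
  inv_val := by
    ext i j σ
    have h := congrFun (congrFun (permMat_mul σ⁻¹ σ) i) j
    rw [inv_mul_cancel, permMat_one] at h
    simpa [Matrix.mul_apply, Matrix.one_apply, apply_ite (fun f : _ → ℤ => f σ)] using h

/-- The embedding of the group scheme `S_n` in `GL_n` as the permutation matrices. -/
def SnToGL (n : ℕ) : SnScheme n ⟶ GLScheme n := Spec.map (CommRingCat.ofHom (glHom (univPerm n)))

/-! ### Actions of `GL_n` and homogeneous spaces -/

/-- A left action of the group scheme `GL_n` on a scheme `X`, given on `T`-points, functorially in
the scheme `T`. -/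
structure GLAction (n : ℕ) (X : Scheme.{0}) where
  smul : ∀ {T : Scheme.{0}}, GL (Fin n) Γ(T, ⊤) → (T ⟶ X) → (T ⟶ X)
  one_smul : ∀ {T : Scheme.{0}} (x : T ⟶ X), smul 1 x = x
  mul_smul : ∀ {T : Scheme.{0}} (M N : GL (Fin n) Γ(T, ⊤)) (x : T ⟶ X),
    smul (M * N) x = smul M (smul N x)
  comp_smul : ∀ {T T' : Scheme.{0}} (f : T' ⟶ T) (M : GL (Fin n) Γ(T, ⊤)) (x : T ⟶ X),
    f ≫ smul M x = smul (Matrix.GeneralLinearGroup.map f.appTop.hom M) (f ≫ x)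

/-- The action of `GL_n` on `𝔅_n`, sending `(A, φ)` to `(A, M ∘ φ)`. -/
def moduliAction (n : ℕ) : GLAction n (moduli n) where
  smul M x := ofAlg ((toAlg x).smul M)
  one_smul x := by rw [BasedAlg.one_smul, ofAlg_toAlg]
  mul_smul M N x := by rw [BasedAlg.mul_smul, toAlg_ofAlg]
  comp_smul f M x := by
    apply (moduliRep n).homEquiv.injective
    change toAlg _ = toAlg _
    rw [toAlg_comp, toAlg_ofAlg, toAlg_ofAlg, toAlg_comp, BasedAlg.map_smul]

/-- The action of `GL_n` on the étale locus, the restriction of the action on `𝔅_n`. -/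
def etaleAction (n : ℕ) : GLAction n (etaleLocus n).toScheme where
  smul M x := IsOpenImmersion.lift (etaleLocus n).ι
    ((moduliAction n).smul M (x ≫ (etaleLocus n).ι)) (by
      rw [Scheme.Opens.range_ι, range_subset_etaleLocus_iff]
      have hx : IsUnit (toAlg (x ≫ (etaleLocus n).ι)).disc := by
        rw [← range_subset_etaleLocus_iff]
        rintro _ ⟨t, rfl⟩
        exact (x t).2
      change IsUnit (toAlg (ofAlg _)).disc
      rw [toAlg_ofAlg, BasedAlg.disc_smul]
      exact (((Matrix.isUnit_iff_isUnit_det _).1 (M⁻¹).isUnit).pow 2).mul hx)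
  one_smul x := by
    rw [← cancel_mono (etaleLocus n).ι, IsOpenImmersion.lift_fac, GLAction.one_smul]
  mul_smul M N x := by
    rw [← cancel_mono (etaleLocus n).ι, IsOpenImmersion.lift_fac, IsOpenImmersion.lift_fac,
      GLAction.mul_smul, IsOpenImmersion.lift_fac]
  comp_smul f M x := by
    rw [← cancel_mono (etaleLocus n).ι, IsOpenImmersion.lift_fac, Category.assoc,
      IsOpenImmersion.lift_fac, GLAction.comp_smul, Category.assoc]

/-- The orbit morphism `GL_n → 𝔅_n^et`, sending `M` to `M • A_split`. -/
def orbitMap (n : ℕ) : GLScheme n ⟶ (etaleLocus n).toScheme :=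
  IsOpenImmersion.lift (etaleLocus n).ι
    (ofAlg ((BasedAlg.split n Γ(GLScheme n, ⊤)).smul (toGL (𝟙 (GLScheme n))))) (by
      rw [Scheme.Opens.range_ι, range_subset_etaleLocus_iff, toAlg_ofAlg, BasedAlg.disc_smul,
        BasedAlg.disc_split, mul_one]
      exact ((Matrix.isUnit_iff_isUnit_det _).1 (toGL (𝟙 (GLScheme n)))⁻¹.isUnit).pow 2)

/-- `X`, with the action `a` of `GL_n` and the morphism `q : GL_n → X`, is the homogeneous space
`GL_n / S_n`: the morphism `q` is `GL_n`-equivariant, and `X` is the quotient, as a sheaf for the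
étale topology, of `GL_n` by the action of `S_n` by right multiplication. In other words, the map
`GL_n(T) / S_n(T) → X(T)` induced by `q` is injective for every scheme `T`, and every `T`-point of
`X` lifts to `GL_n` over some étale surjective `T' → T`. -/
structure IsHomogeneousSpace {n : ℕ} {X : Scheme.{0}} (a : GLAction n X) (q : GLScheme n ⟶ X) :
    Prop where
  equivariant : ∀ {T : Scheme.{0}} (M N : GL (Fin n) Γ(T, ⊤)),
    ofGL (M * N) ≫ q = a.smul M (ofGL N ≫ q)
  eq_iff : ∀ {T : Scheme.{0}} (M N : GL (Fin n) Γ(T, ⊤)),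
    ofGL M ≫ q = ofGL N ≫ q ↔ ∃ s : T ⟶ SnScheme n, N = M * toGL (s ≫ SnToGL n)
  exists_lift : ∀ {T : Scheme.{0}} (x : T ⟶ X), ∃ (T' : Scheme.{0}) (f : T' ⟶ T)
    (M : GL (Fin n) Γ(T', ⊤)), Etale f ∧ Surjective f ∧ f ≫ x = ofGL M ≫ q

/-! ### The fibers -/

/-- The fiber `𝔅_{n,k} = 𝔅_n ×_{Spec ℤ} Spec k` over a field `k`. -/
def moduliFiber (n : ℕ) (k : Type u) [Field k] : Scheme.{u} := Spec (.of (k ⊗[ℤ] CoordRing n))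

/-- The fiber `𝔅_{n,k}^et` of the étale locus: the open subscheme of `𝔅_{n,k}` where the
function `Δ` is invertible. -/
def etaleLocusFiber (n : ℕ) (k : Type u) [Field k] : (moduliFiber n k).Opens :=
  PrimeSpectrum.basicOpen ((1 : k) ⊗ₜ[ℤ] discFun n)

end

end BasedAlgebras

/-! An isomorphism of the split algebra with a based algebra `A` is a complete system of orthogonal
idempotents in `A`: `M` carries the split algebra to `A` exactly when the columns of `M` form such a
system (`smul_split_eq_iff`). Complete orthogonal idempotents lift uniquely along square-zero
extensions, so the orbit morphism is formally étale, and finite presentation makes it étale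
(`etale_orbitHom`). Over an algebraically closed field a nonzero discriminant forces the algebra to
be reduced, hence a product of copies of the field (`exists_smul_split_eq`), so the image of `GL_n`
is the étale locus.

Thus `GL_n` is itself an étale cover of the étale locus, and pulling it back along a point lifts
that point étale-locally. Two matrices give the same point when they differ by an automorphism of
the split algebra. The rows of such an automorphism are complete systems of orthogonal idempotents
of the base ring, and their products cut the base into pieces on which the matrix is a permutation
matrix (`exists_eq_map_univPerm`). Any other homogeneous space is compared with this one by descent,
étale surjections being effective epimorphisms (`IsHomogeneousSpace.exists_iso`).

Irreducibility passes from `GL_n`, whose coordinate ring is a domain over `ℤ` and stays one over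
every field, to its image. For the dimension, `GL_n` is integral over the étale locus
(`isIntegral_etaleOrbitHom`): the rows of the inverse universal matrix are characters of the
universal algebra. This survives base change to `k`, so the étale fiber has the dimension `n ^ 2` of
`GL_n`. Its closure is no larger, since its reduced coordinate ring embeds in that of `GL_n` over
`k`. -/

namespace BasedAlgebras

noncomputable section

/-! ### Splittings of a based algebra as systems of orthogonal idempotents -/

namespace BasedAlg

variable {n : ℕ} {R : Type u} {S : Type v} [CommRing R] [CommRing S]

/-- The underlying algebra of a based algebra: `R ^ n` with the multiplication `A.mul`. -/
def Carrier (_A : BasedAlg n R) : Type u := Fin n → R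

namespace Carrier

variable (A : BasedAlg n R)

instance : AddCommGroup A.Carrier := inferInstanceAs (AddCommGroup (Fin n → R))

instance : Module R A.Carrier := inferInstanceAs (Module R (Fin n → R))

instance : CommRing A.Carrier :=
  { (inferInstance : AddCommGroup A.Carrier) with
    mul := fun x y => A.mul x y
    one := A.d
    left_distrib := fun x y z => map_add (A.mul x) y z
    right_distrib := fun x y z => LinearMap.map_add₂ A.mul x y z
    zero_mul := fun x => LinearMap.map_zero₂ A.mul x
    mul_zero := fun x => map_zero (A.mul x)
    mul_assoc := A.mul_assoc'
    one_mul := A.one_mul'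
    mul_one := fun x => (A.mul_comm' x A.d).trans (A.one_mul' x)
    mul_comm := A.mul_comm' }

instance : Algebra R A.Carrier :=
  Algebra.ofModule (fun r x y => LinearMap.map_smul₂ A.mul r x y)
    (fun r x y => _root_.map_smul (A.mul x) r y)

/-- The coordinates of an element. -/
def coord : A.Carrier ≃ₗ[R] (Fin n → R) := LinearEquiv.refl R (Fin n → R)

lemma coord_mul (x y : A.Carrier) : coord A (x * y) = A.mul (coord A x) (coord A y) := rfl

lemma coord_one : coord A 1 = A.d := rfl

instance : Module.Finite R A.Carrier := .equiv (coord A).symm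

/-- The ring homomorphism induced by a base change. -/
def mapHom (f : R →+* S) : A.Carrier →+* (A.map f).Carrier where
  toFun x := (coord (A.map f)).symm (f ∘ coord A x)
  map_one' := rfl
  map_mul' x y := (A.mul_map f _ _).symm
  map_zero' := by
    apply (coord (A.map f)).injective
    ext i; simp
  map_add' x y := by
    apply (coord (A.map f)).injective
    ext i; simp

end Carrier

open Carrier

/-- A based algebra is determined by an algebra isomorphic to it and the transported basis. -/
lemma eq_ofEquiv {B : Type v} [CommRing B] [Algebra R B] (A : BasedAlg n R) (φ : B ≃ₐ[R] A.Carrier) :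
    A = ofEquiv (φ.toLinearEquiv.trans (coord A)) := by
  refine ext_mul ?_ ?_
  · refine LinearMap.ext₂ fun x y => ?_
    rw [ofEquiv, mul_ofMul]
    simp [coord_mul]
  · change _ = coord A (φ 1)
    rw [map_one, coord_one]

lemma split_mul (x y : Fin n → R) : (split n R).mul x y = x * y := by
  rw [split, ofEquiv, mul_ofMul]; rfl

lemma e_mul_e (i j : Fin n) : e n R i * e n R j = if i = j then e n R i else 0 := by
  rw [e, e, ← Pi.single_mul_left]
  split_ifs with h
  · simp [h]
  · simp [h]

lemma split_d : (split n R).d = 1 := rfl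

lemma map_split (f : R →+* S) : (split n R).map f = split n S := by
  refine BasedAlg.ext ?_ ?_
  · funext i j l
    change f ((split n R).c i j l) = (split n S).c i j l
    rw [← mul_e, ← mul_e, split_mul, split_mul]
    simp [e, Pi.single_apply, apply_ite f]
  · funext i
    exact map_one f

/-- The `j`-th column of a matrix as an element of a based algebra. -/
def col (A : BasedAlg n R) (M : Matrix (Fin n) (Fin n) R) (j : Fin n) : A.Carrier :=
  (coord A).symm fun i => M i j

/-- The based algebra `M • A_split` is characterized by the condition that the columns of `M` are
complete orthogonal idempotents. -/
lemma smul_split_eq_iff (A : BasedAlg n R) (M : GL (Fin n) R) :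
    (split n R).smul M = A ↔ CompleteOrthogonalIdempotents (A.col M.1) := by
  have hM : ∀ x : Fin n → R, M.1 *ᵥ ((M⁻¹ : GL (Fin n) R).1 *ᵥ x) = x := fun x => by
    rw [Matrix.mulVec_mulVec, ← Units.val_mul, mul_inv_cancel]; simp
  have hM' : ∀ x : Fin n → R, (M⁻¹ : GL (Fin n) R).1 *ᵥ (M.1 *ᵥ x) = x := fun x => by
    rw [Matrix.mulVec_mulVec, ← Units.val_mul, inv_mul_cancel]; simp
  have hcol : ∀ j, coord A (A.col M.1 j) = M.1 *ᵥ e n R j := fun j => by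
    ext i; simp [col, e]
  have hsum : coord A (∑ j, A.col M.1 j) = M.1 *ᵥ 1 := by
    ext i; simp [col, Matrix.mulVec, dotProduct]
  have hiff : CompleteOrthogonalIdempotents (A.col M.1) ↔ (∀ i j, A.col M.1 i * A.col M.1 j =
      if i = j then A.col M.1 i else 0) ∧ ∑ i, A.col M.1 i = 1 :=
    ⟨fun h => ⟨OrthogonalIdempotents.iff_mul_eq.1 h.1, h.2⟩,
      fun h => ⟨OrthogonalIdempotents.iff_mul_eq.2 h.1, h.2⟩⟩
  rw [hiff]
  constructor
  · rintro rfl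
    refine ⟨fun i j => (coord _).injective ?_, (coord _).injective ?_⟩
    · rw [coord_mul, hcol, hcol, smul_mul, hM', hM', split_mul, e_mul_e]
      split_ifs with h
      · rw [hcol]
      · rw [map_zero, Matrix.mulVec_zero]
    · rw [hsum]; rfl
  · rintro ⟨h1, h2⟩
    refine ext_mul ?_ ?_
    -- Multiplicativity of `M` only needs checking on basis vectors, where it is the orthogonality
    -- relation `h1`.
    · have key : (A.mul.compl₁₂ (Matrix.toLin' M.1) (Matrix.toLin' M.1)) =
          (split n R).mul.compr₂ (Matrix.toLin' M.1) := by
        refine ext_of_e fun i => ext_of_e fun j => ?_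
        have := congrArg (coord A) (h1 i j)
        simp only [LinearMap.compl₁₂_apply, LinearMap.compr₂_apply, Matrix.toLin'_apply,
          split_mul]
        rw [coord_mul, hcol, hcol] at this
        rw [this, e_mul_e]
        split_ifs with h
        · rw [hcol]
        · rw [map_zero, Matrix.mulVec_zero]
      refine LinearMap.ext₂ fun x y => ?_
      have := LinearMap.congr_fun₂ key ((M⁻¹ : GL (Fin n) R).1 *ᵥ x) ((M⁻¹ : GL (Fin n) R).1 *ᵥ y)
      simp only [LinearMap.compl₁₂_apply, LinearMap.compr₂_apply, Matrix.toLin'_apply, hM] at this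
      rw [smul_mul, this]
    · rw [← coord_one A, ← h2, hsum]; rfl

lemma mem_ker_mapHom {A : BasedAlg n R} {f : R →+* S} {x : A.Carrier} :
    x ∈ RingHom.ker (mapHom A f) ↔ ∀ i, coord A x i ∈ RingHom.ker f := by
  rw [RingHom.mem_ker, ← (coord (A.map f)).map_eq_zero_iff, funext_iff]
  rfl

/-- Base change along a surjection with square-zero kernel has a square-zero kernel. -/
lemma isNilpotent_of_mem_ker_mapHom (A : BasedAlg n R) {I : Ideal R} (hI : I ^ 2 = ⊥)
    (x : A.Carrier) (hx : x ∈ RingHom.ker (mapHom A (Ideal.Quotient.mk I))) : IsNilpotent x := by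
  rw [mem_ker_mapHom] at hx
  simp only [Ideal.mk_ker] at hx
  refine ⟨2, (coord A).injective ?_⟩
  rw [pow_two, coord_mul, map_zero]
  ext l
  rw [mul_apply]
  refine Finset.sum_eq_zero fun i _ => Finset.sum_eq_zero fun j _ => ?_
  have : coord A x i * coord A x j ∈ I ^ 2 := by
    rw [pow_two]; exact Ideal.mul_mem_mul (hx i) (hx j)
  rw [hI, Ideal.mem_bot] at this
  rw [this, zero_mul]

lemma mapHom_col (A : BasedAlg n R) (f : R →+* S) (M : Matrix (Fin n) (Fin n) R) (j : Fin n) :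
    mapHom A f (A.col M j) = (A.map f).col (M.map f) j := rfl

/-- An isomorphism with the split algebra lifts uniquely along square-zero extensions. -/
lemma existsUnique_smul_split (A : BasedAlg n R) {I : Ideal R} (hI : I ^ 2 = ⊥)
    (M : GL (Fin n) (R ⧸ I)) (hM : (split n (R ⧸ I)).smul M = A.map (Ideal.Quotient.mk I)) :
    ∃! N : GL (Fin n) R, (split n R).smul N = A ∧
      Matrix.GeneralLinearGroup.map (Ideal.Quotient.mk I) N = M := by
  set f := Ideal.Quotient.mk I
  rw [smul_split_eq_iff] at hM
  -- The columns of `M` are idempotents of `A` modulo `I`; they lift because the kernel of reduction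
  -- is nil.
  obtain ⟨e', he', h⟩ := CompleteOrthogonalIdempotents.lift_of_isNilpotent_ker (mapHom A f)
    (A.isNilpotent_of_mem_ker_mapHom hI) hM (fun j => by
      choose g hg using fun i => Ideal.Quotient.mk_surjective (I := I) (M.1 i j)
      refine ⟨(coord A).symm g, ?_⟩
      apply (coord (A.map f)).injective
      ext i
      exact hg i)
  let P : Matrix (Fin n) (Fin n) R := Matrix.of fun i j => coord A (e' j) i
  have hP : P.map f = M.1 := by
    ext i j
    exact congrFun (congrArg (coord (A.map f)) (congrFun h j)) i
  have hdet : IsUnit P.det := by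
    rw [← IsNilpotent.isUnit_quotient_mk_iff (I := I) ⟨2, hI⟩, RingHom.map_det, RingHom.mapMatrix_apply, hP]
    exact (Matrix.isUnit_iff_isUnit_det _).1 M.isUnit
  refine ⟨Matrix.GeneralLinearGroup.mk'' P hdet, ⟨?_, ?_⟩, ?_⟩
  · rw [smul_split_eq_iff]
    exact he'
  · ext i j
    exact congrFun (congrFun hP i) j
  · rintro N ⟨h1, h2⟩
    rw [smul_split_eq_iff] at h1
    ext i j
    -- Two commuting idempotents whose difference is nilpotent are equal, which gives uniqueness.
    have : A.col N.1 j = e' j := by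
      refine eq_of_isNilpotent_sub_of_isIdempotentElem (h1.idem j) (he'.idem j) ?_
      refine A.isNilpotent_of_mem_ker_mapHom hI _ ?_
      rw [RingHom.mem_ker, map_sub, sub_eq_zero, mapHom_col]
      refine Eq.trans ?_ (congrFun h j).symm
      rw [← h2]
      rfl
    exact congrFun (congrArg (coord A) this) i

/-- Multiplication by a nilpotent element is nilpotent. -/
lemma isNilpotent_mul (A : BasedAlg n R) {x : A.Carrier} (hx : IsNilpotent x) :
    IsNilpotent (A.mul (coord A x) : Module.End R (Fin n → R)) := by
  obtain ⟨k, hk⟩ := hx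
  have h : ∀ (m : ℕ) (y : A.Carrier),
      ((A.mul (coord A x) : Module.End R (Fin n → R)) ^ m) (coord A y) =
        coord A (x ^ m * y) := fun m => by
    induction m with
    | zero => intro y; simp
    | succ m ih =>
      intro y
      rw [pow_succ, Module.End.mul_apply, ← coord_mul, ih, pow_succ, mul_assoc]
  refine ⟨k, LinearMap.ext fun y => ?_⟩
  have := h k ((coord A).symm y)
  rwa [hk, zero_mul, map_zero, LinearEquiv.apply_symm_apply] at this

/-- Over an algebraically closed field, a based algebra with nonzero discriminant is split. -/
lemma exists_smul_split_eq {K : Type u} [Field K] [IsAlgClosed K] (A : BasedAlg n K)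
    (hA : A.disc ≠ 0) : ∃ M : GL (Fin n) K, (split n K).smul M = A := by
  have hred : IsReduced A.Carrier := by
    refine ⟨fun x hx => ?_⟩
    -- A nilpotent `x` lies in the radical of the trace form: each `e_i * x` is nilpotent, so its
    -- trace vanishes. A nonzero discriminant then forces `x = 0`.
    have h : (Matrix.of fun i j => LinearMap.trace K (Fin n → K)
        (A.mul (A.mul (e n K i) (e n K j)))) *ᵥ coord A x = 0 := by
      ext i
      have hnil : IsNilpotent (A.mul (A.mul (e n K i) (coord A x)) : Module.End K (Fin n → K)) :=
        A.isNilpotent_mul ((Commute.all ((coord A).symm (e n K i)) x).isNilpotent_mul_left hx)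
      have h0 := (LinearMap.isNilpotent_trace_of_isNilpotent hnil).eq_zero
      rw [Pi.zero_apply, ← h0]
      have key : ∀ v : Fin n → K, v = ∑ m, v m • e n K m := fun v => by
        ext l; simp [e, Pi.single_apply]
      conv_rhs => rw [key (coord A x)]
      simp only [map_sum, _root_.map_smul, smul_eq_mul, Matrix.mulVec, dotProduct, Matrix.of_apply]
      exact Finset.sum_congr rfl fun j _ => mul_comm _ _
    exact (coord A).injective (Matrix.eq_zero_of_mulVec_eq_zero hA h)
  have : IsArtinianRing A.Carrier := .of_finite K A.Carrier
  let (m : MaximalSpectrum A.Carrier) : Field (A.Carrier ⧸ m.asIdeal) :=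
    Ideal.Quotient.field m.asIdeal
  -- A reduced Artinian ring is the product of its residue fields, and each of these is integral
  -- over the algebraically closed `K`, hence equal to it.
  let φ : A.Carrier ≃ₐ[K] (MaximalSpectrum A.Carrier → K) :=
    ((IsArtinianRing.equivPi _).restrictScalars K).trans
      (AlgEquiv.piCongrRight fun _ => (AlgEquiv.ofBijective (Algebra.ofId K _)
        IsAlgClosed.algebraMap_bijective_of_isIntegral).symm)
  have : Fintype (MaximalSpectrum A.Carrier) := Fintype.ofFinite _
  have hcard : Fintype.card (MaximalSpectrum A.Carrier) = n := by
    have := (φ.toLinearEquiv.symm.trans (coord A)).finrank_eq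
    simpa using this
  let ψ : (Fin n → K) ≃ₐ[K] A.Carrier :=
    (AlgEquiv.piCongrLeft K (fun _ => K) (Fintype.equivFinOfCardEq hcard).symm).trans φ.symm
  refine ⟨Matrix.GeneralLinearGroup.toLin.symm
    (LinearMap.GeneralLinearGroup.ofLinearEquiv (ψ.toLinearEquiv.trans (coord A))), ?_⟩
  refine Eq.trans ?_ (A.eq_ofEquiv ψ).symm
  rw [split, smul_ofEquiv]
  congr 1
  ext x
  simp

end BasedAlg

end

end BasedAlgebras

/-! ### The orbit morphism on coordinate rings: étaleness and image -/

namespace BasedAlgebras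

noncomputable section

variable {n : ℕ} {R : Type u} {S : Type v} [CommRing R] [CommRing S]

open BasedAlg

lemma comp_algHom (f : R →+* S) (A : BasedAlg n R) : f.comp (algHom A) = algHom (A.map f) := by
  rw [← algHom_univAlg_map (f.comp (algHom A))]
  congr 1
  conv_rhs => rw [← univAlg_map_algHom A]
  rfl

lemma comp_glHom (f : R →+* S) (M : GL (Fin n) R) :
    f.comp (glHom M) = glHom (Matrix.GeneralLinearGroup.map f M) := by
  rw [← glHom_map_univGL (f.comp (glHom M))]
  congr 1
  conv_rhs => rw [← map_glHom_univGL M]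
  rfl

/-- The ring homomorphism corresponding to the orbit morphism `GL_n → 𝔅_n`. -/
def orbitHom (n : ℕ) : CoordRing n →+* GLRing n :=
  algHom ((split n (GLRing n)).smul (univGL n))

lemma comp_orbitHom (f : GLRing n →+* R) :
    f.comp (orbitHom n) =
      algHom ((split n R).smul (Matrix.GeneralLinearGroup.map f (univGL n))) := by
  rw [orbitHom, comp_algHom, BasedAlg.map_smul, map_split]

lemma glHom_comp_orbitHom (M : GL (Fin n) R) :
    (glHom M).comp (orbitHom n) = algHom ((split n R).smul M) := by
  rw [comp_orbitHom, map_glHom_univGL]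

lemma univAlg_map_comp_orbitHom (f : GLRing n →+* R) :
    (univAlg n).map (f.comp (orbitHom n)) =
      (split n R).smul (Matrix.GeneralLinearGroup.map f (univGL n)) := by
  rw [comp_orbitHom, univAlg_map_algHom]

/-- For a `CoordRing n`-algebra `B`, algebra maps `GLRing n → B` are the matrices carrying the split
algebra to the based algebra over `B`. The lifting property is therefore `existsUnique_smul_split`.
-/
lemma formallyEtale_orbitHom (n : ℕ) : (orbitHom n).FormallyEtale := by
  algebraize [orbitHom n]
  refine Algebra.FormallyEtale.iff_comp_bijective.2 fun B _ _ I hI => ?_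
  set A := (univAlg n).map (algebraMap (CoordRing n) B) with hA
  have hcomp : ∀ φ : GLRing n →ₐ[CoordRing n] B,
      (split n B).smul (Matrix.GeneralLinearGroup.map (φ : GLRing n →+* B) (univGL n)) = A :=
    fun φ => by
      rw [← univAlg_map_comp_orbitHom, hA]
      exact congrArg (fun f => (univAlg n).map f) φ.comp_algebraMap
  have hM : ∀ φ : GLRing n →ₐ[CoordRing n] B ⧸ I, (split n (B ⧸ I)).smul
      (Matrix.GeneralLinearGroup.map (φ : GLRing n →+* B ⧸ I) (univGL n)) =
        A.map (Ideal.Quotient.mk I) := fun φ => by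
    rw [← univAlg_map_comp_orbitHom]
    exact congrArg (fun f => (univAlg n).map f) φ.comp_algebraMap
  constructor
  · intro φ ψ h
    refine AlgHom.coe_ringHom_injective ?_
    rw [← glHom_map_univGL (φ : GLRing n →+* B), ← glHom_map_univGL (ψ : GLRing n →+* B)]
    congr 1
    refine (A.existsUnique_smul_split hI _ (hM ((Ideal.Quotient.mkₐ _ I).comp φ))).unique
      ⟨hcomp φ, rfl⟩ ⟨hcomp ψ, ?_⟩
    rw [h]
    rfl
  · intro φ
    obtain ⟨N, ⟨h1, h2⟩, -⟩ := A.existsUnique_smul_split hI _ (hM φ)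
    refine ⟨⟨glHom N, fun r => ?_⟩, ?_⟩
    · refine (RingHom.congr_fun (glHom_comp_orbitHom N) r).trans ?_
      rw [h1, hA, algHom_univAlg_map]
    · refine AlgHom.coe_ringHom_injective ?_
      refine (comp_glHom (Ideal.Quotient.mk I) N).trans ?_
      rw [h2, glHom_map_univGL]

/-- Finite presentation over `CoordRing n` follows from finite presentation over `ℤ`, as `CoordRing
n` is of finite type over `ℤ`. -/
lemma etale_orbitHom (n : ℕ) : (orbitHom n).Etale := by
  have h := formallyEtale_orbitHom n
  algebraize [orbitHom n]
  have h0 := IsScalarTower.of_algebraMap_eq' (R := ℤ) (S := CoordRing n) (A := GLRing n)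
    (Subsingleton.elim _ _)
  have h1 : Algebra.FinitePresentation ℤ (GLRing n) :=
    .trans ℤ (MvPolynomial (Fin n × Fin n) ℤ) (GLRing n)
  have h2 : Algebra.FinitePresentation (CoordRing n) (GLRing n) :=
    .of_restrict_scalars_finitePresentation ℤ _ _
  exact { }

/-- A geometric point of `𝔅_n` where the discriminant does not vanish is in the orbit of the split
algebra. -/
lemma exists_comp_orbitHom {K : Type u} [Field K] [IsAlgClosed K] (f : CoordRing n →+* K)
    (hf : f (discFun n) ≠ 0) : ∃ M : GL (Fin n) K, (glHom M).comp (orbitHom n) = f := by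
  obtain ⟨M, hM⟩ := exists_smul_split_eq ((univAlg n).map f) (by rwa [disc_map])
  exact ⟨M, by rw [glHom_comp_orbitHom, hM, algHom_univAlg_map]⟩

lemma disc_smul_split (M : GL (Fin n) R) :
    ((split n R).smul M).disc = ((M⁻¹ : GL (Fin n) R).1.det) ^ 2 := by
  rw [disc_smul, disc_split, mul_one]

lemma orbitHom_discFun (n : ℕ) :
    orbitHom n (discFun n) = (((univGL n)⁻¹ : GL (Fin n) (GLRing n)).1.det) ^ 2 := by
  rw [discFun, ← disc_map, orbitHom, univAlg_map_algHom, disc_smul_split]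

lemma isUnit_orbitHom_discFun (n : ℕ) : IsUnit (orbitHom n (discFun n)) := by
  rw [orbitHom_discFun]
  exact ((Matrix.isUnit_iff_isUnit_det _).1 (univGL n)⁻¹.isUnit).pow 2

/-- The image of `GL_n` in `𝔅_n` is the étale locus. -/
lemma range_comap_eq_basicOpen {A : Type u} {B : Type v} [CommRing A] [CommRing B] {φ : A →+* B}
    {d : A} (hd : IsUnit (φ d))
    (hφ : ∀ (K : Type u) [Field K] [IsAlgClosed K] (f : A →+* K), f d ≠ 0 →
      ∃ g : B →+* K, g.comp φ = f) :
    Set.range (PrimeSpectrum.comap φ) = PrimeSpectrum.basicOpen d := by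
  refine Set.Subset.antisymm ?_ fun p hp => ?_
  · rintro _ ⟨q, rfl⟩
    exact fun h => q.2.ne_top (Ideal.eq_top_of_isUnit_mem _ h hd)
  -- The prime `p` is the kernel of the geometric point `f`; a factorization of `f` through `φ`
  -- provides a prime of `B` above `p`.
  · let K := AlgebraicClosure p.asIdeal.ResidueField
    let f : A →+* K := (algebraMap p.asIdeal.ResidueField K).comp
      (algebraMap A p.asIdeal.ResidueField)
    have hker : RingHom.ker f = p.asIdeal := by
      rw [RingHom.ker_comp_of_injective _ (algebraMap p.asIdeal.ResidueField K).injective]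
      exact Ideal.ker_algebraMap_residueField _
    obtain ⟨g, hg⟩ := hφ K f (fun h => hp (by rw [← hker]; exact h))
    refine ⟨⟨RingHom.ker g, RingHom.ker_isPrime _⟩, ?_⟩
    ext1
    change Ideal.comap _ (RingHom.ker g) = _
    rw [RingHom.comap_ker, hg, hker]

lemma range_comap_orbitHom (n : ℕ) :
    Set.range (PrimeSpectrum.comap (orbitHom n)) = PrimeSpectrum.basicOpen (discFun n) :=
  range_comap_eq_basicOpen (isUnit_orbitHom_discFun n) fun _ _ _ f hf =>
    (exists_comp_orbitHom f hf).imp' _ fun _ h => h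

/-! ### The stabilizer of the split algebra -/

/-- Multiplication in the split algebra is coordinatewise, so the condition on the columns can be
read one row at a time: each row is a complete system of orthogonal idempotents of `R`. -/
lemma smul_split_eq_split_iff (P : GL (Fin n) R) :
    (split n R).smul P = split n R ↔
      (∀ i j k, P.1 k i * P.1 k j = if i = j then P.1 k i else 0) ∧ ∀ k, ∑ j, P.1 k j = 1 := by
  have hcol : ∀ j, Carrier.coord _ ((split n R).col P.1 j) = fun k => P.1 k j := fun j => rfl
  have hiff : CompleteOrthogonalIdempotents ((split n R).col P.1) ↔
      (∀ i j, (split n R).col P.1 i * (split n R).col P.1 j =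
        if i = j then (split n R).col P.1 i else 0) ∧ ∑ i, (split n R).col P.1 i = 1 :=
    ⟨fun h => ⟨OrthogonalIdempotents.iff_mul_eq.1 h.1, h.2⟩,
      fun h => ⟨OrthogonalIdempotents.iff_mul_eq.2 h.1, h.2⟩⟩
  rw [smul_split_eq_iff, hiff]
  refine and_congr (forall_congr' fun i => forall_congr' fun j => ?_) ?_
  · rw [← (Carrier.coord (split n R)).injective.eq_iff, Carrier.coord_mul, hcol, hcol, split_mul,
      funext_iff]
    refine forall_congr' fun k => ?_
    split_ifs with h
    · rfl
    · rfl
  · rw [← (Carrier.coord (split n R)).injective.eq_iff, map_sum, Carrier.coord_one, split_d,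
      funext_iff]
    refine forall_congr' fun k => ?_
    simp [hcol]

lemma smul_univPerm_split (n : ℕ) :
    (split n (Equiv.Perm (Fin n) → ℤ)).smul (univPerm n) = split n _ := by
  rw [smul_split_eq_split_iff]
  refine ⟨fun i j k => ?_, fun k => ?_⟩
  · ext σ
    by_cases h : i = j
    · simp [univPerm, permMat, h]
    · simp only [univPerm, permMat, Matrix.of_apply, Pi.mul_apply, if_neg h, Pi.zero_apply]
      split_ifs with h1 h2 <;> simp
      exact h (σ.injective (h1.symm.trans h2))
  · ext σ
    simp only [univPerm, permMat, Matrix.of_apply, Finset.sum_apply, Pi.one_apply]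
    rw [Finset.sum_eq_single (σ.symm k)]
    · simp
    · intro b _ hb
      rw [if_neg]
      rintro rfl
      simp at hb
    · simp

/-- An automorphism of the split algebra is locally given by a permutation. -/
lemma exists_eq_map_univPerm (P : GL (Fin n) R) (hP : (split n R).smul P = split n R) :
    ∃ f : (Equiv.Perm (Fin n) → ℤ) →+* R, P = Matrix.GeneralLinearGroup.map f (univPerm n) := by
  -- The idempotent `δ f` cuts out the part of the base where, for every `i`, row `i` of `P` has its
  -- entry `1` in column `f i`.
  obtain ⟨h1, h2⟩ := (smul_split_eq_split_iff P).1 hP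
  let δ : (Fin n → Fin n) → R := fun f => ∏ i, P.1 i (f i)
  have hδ : ∀ i j f, P.1 i j * δ f = if j = f i then δ f else 0 := fun i j f => by
    have : δ f = P.1 i (f i) * ∏ i' ∈ Finset.univ.erase i, P.1 i' (f i') :=
      (Finset.mul_prod_erase _ _ (Finset.mem_univ i)).symm
    rw [this, ← mul_assoc, h1]
    split_ifs with h
    · rw [h]
    · rw [zero_mul]
  -- If `f a = f b`, rows `a` and `b` agree after multiplication by `δ f`, so `δ f * det P = 0`; the
  -- determinant is a unit.
  have hinj : ∀ f, δ f ≠ 0 → Function.Injective f := fun f hf a b hab => by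
    by_contra hne
    refine hf (((Matrix.isUnit_iff_isUnit_det _).1 P.isUnit).mul_left_cancel ?_)
    rw [mul_zero, mul_comm]
    have hrow : δ f • P.1 a = δ f • P.1 b := by
      ext j
      simp only [Pi.smul_apply, smul_eq_mul]
      rw [mul_comm, hδ, mul_comm, hδ, hab]
    calc δ f * P.1.det = (P.1.updateRow a (δ f • P.1 a)).det := by
          rw [Matrix.det_updateRow_smul, Matrix.updateRow_eq_self]
      _ = δ f * (P.1.updateRow a (P.1 b)).det := by rw [hrow, Matrix.det_updateRow_smul]
      _ = 0 := by
          rw [Matrix.det_zero_of_row_eq hne, mul_zero]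
          rw [Matrix.updateRow_self, Matrix.updateRow_ne (Ne.symm hne)]
  -- Expanding the product of the row sums, all equal to `1`, gives the sum over all functions, of
  -- which only bijections contribute. The inverse appears because row `i` of the permutation matrix
  -- of `σ` has its `1` in column `σ⁻¹ i`.
  have hsum : ∑ σ : Equiv.Perm (Fin n), δ (σ⁻¹ : Equiv.Perm (Fin n)) = 1 := by
    have h3 : ∑ f, δ f = 1 := by
      have := Finset.prod_univ_sum (fun _ : Fin n => Finset.univ) (fun i j => P.1 i j)
      rw [Fintype.piFinset_univ] at this
      rw [← this]
      exact Finset.prod_eq_one fun k _ => h2 k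
    rw [← h3]
    refine Fintype.sum_of_injective (fun σ : Equiv.Perm (Fin n) => ⇑σ⁻¹)
      (fun σ τ h => inv_injective (DFunLike.coe_injective h)) _ _ (fun f hf => ?_) fun _ => rfl
    by_contra hne
    refine hf ⟨(Equiv.ofBijective f (Finite.injective_iff_bijective.1 (hinj f hne)))⁻¹, ?_⟩
    beta_reduce
    rw [inv_inv]; rfl
  have hmul : ∀ f g, δ f * δ g = if f = g then δ f else 0 := fun f g => by
    split_ifs with h
    · subst h
      refine Finset.prod_mul_distrib.symm.trans (Finset.prod_congr rfl fun i _ => ?_)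
      rw [h1, if_pos rfl]
    · obtain ⟨i, hi⟩ := Function.ne_iff.1 h
      have : δ f = P.1 i (f i) * ∏ i' ∈ Finset.univ.erase i, P.1 i' (f i') :=
        (Finset.mul_prod_erase _ _ (Finset.mem_univ i)).symm
      rw [this, mul_right_comm, hδ, if_neg hi, zero_mul]
  let ε : Equiv.Perm (Fin n) → R := fun σ => δ (σ⁻¹ : Equiv.Perm (Fin n))
  have hε : ∀ σ τ, ε σ * ε τ = if σ = τ then ε σ else 0 := fun σ τ => by
    simp only [ε, hmul, DFunLike.coe_fn_eq, inv_inj]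
  -- A complete orthogonal system of idempotents indexed by permutations is the same as a ring
  -- homomorphism from the functions on `S_n`.
  let f : (Equiv.Perm (Fin n) → ℤ) →+* R :=
    { toFun := fun g => ∑ σ, (g σ : R) * ε σ
      map_one' := by simpa only [Pi.one_apply, Int.cast_one, _root_.one_mul] using hsum
      map_zero' := by simp
      map_add' := fun g h => by simp [add_mul, Finset.sum_add_distrib]
      map_mul' := fun g h => by
        rw [Finset.sum_mul_sum]
        refine Finset.sum_congr rfl fun σ _ => ?_
        rw [Finset.sum_eq_single σ]
        · rw [mul_mul_mul_comm, hε, if_pos rfl]; simp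
        · intro τ _ h
          rw [mul_mul_mul_comm, hε, if_neg h.symm, mul_zero]
        · simp }
  refine ⟨f, ?_⟩
  ext i j
  change P.1 i j = ∑ σ : Equiv.Perm (Fin n), ((permMat σ i j : ℤ) : R) * ε σ
  rw [← mul_one (P.1 i j), ← hsum, Finset.mul_sum]
  refine Finset.sum_congr rfl fun σ _ => ?_
  rw [hδ]
  simp only [permMat, Matrix.of_apply]
  by_cases h : i = σ j
  · rw [if_pos h, if_pos (by rw [h]; simp)]; simp [ε]
  · rw [if_neg h, if_neg]
    · simp
    · rintro rfl; simp at h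

lemma smul_split_eq_smul_split_iff (M N : GL (Fin n) R) :
    (split n R).smul M = (split n R).smul N ↔
      ∃ f : (Equiv.Perm (Fin n) → ℤ) →+* R,
        N = M * Matrix.GeneralLinearGroup.map f (univPerm n) := by
  constructor
  · intro h
    obtain ⟨f, hf⟩ := exists_eq_map_univPerm (M⁻¹ * N) (by
      rw [BasedAlg.mul_smul, ← h, ← BasedAlg.mul_smul, inv_mul_cancel, BasedAlg.one_smul])
    exact ⟨f, by rw [← hf, mul_inv_cancel_left]⟩
  · rintro ⟨f, rfl⟩
    rw [BasedAlg.mul_smul, ← map_split f, ← BasedAlg.map_smul, smul_univPerm_split]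

end

end BasedAlgebras

namespace BasedAlgebras

noncomputable section

open BasedAlg Limits

variable {n : ℕ}

/-! ### Uniqueness of homogeneous spaces -/

lemma toGL_ofGL {T : Scheme.{0}} (M : GL (Fin n) Γ(T, ⊤)) : toGL (ofGL M) = M :=
  (glRep n).homEquiv.apply_symm_apply M

lemma toGL_comp {T T' : Scheme.{0}} (f : T' ⟶ T) (g : T ⟶ GLScheme n) :
    toGL (f ≫ g) = Matrix.GeneralLinearGroup.map f.appTop.hom (toGL g) :=
  (glRep n).homEquiv_comp f g

lemma exists_eq_ofGL {T : Scheme.{0}} (g : T ⟶ GLScheme n) : ∃ M, g = ofGL M :=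
  ⟨toGL g, ((glRep n).homEquiv.symm_apply_apply g).symm⟩

lemma epi_of_etale_of_surjective {X Y : Scheme.{u}} (f : X ⟶ Y) [Etale f] [Surjective f] :
    Epi f := inferInstance

namespace IsHomogeneousSpace

variable {X Y : Scheme.{0}} {a : GLAction n X} {q : GLScheme n ⟶ X} {b : GLAction n Y}
  {r : GLScheme n ⟶ Y}

/-- Both equalities mean that the two points differ by a point of `S_n`, a condition that involves
neither quotient. -/
lemma comp_eq_comp_iff (hX : IsHomogeneousSpace a q) (hY : IsHomogeneousSpace b r)
    {T : Scheme.{0}} (g h : T ⟶ GLScheme n) : g ≫ q = h ≫ q ↔ g ≫ r = h ≫ r := by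
  obtain ⟨M, rfl⟩ := exists_eq_ofGL g
  obtain ⟨N, rfl⟩ := exists_eq_ofGL h
  rw [hX.eq_iff, hY.eq_iff]

/-- The identity of `X`, viewed as a point of `X`, lifts to `GL_n` on an étale cover. Composing the
lift with `r` gives a morphism that agrees on overlaps by `comp_eq_comp_iff`, hence descends to `X`.
-/
lemma exists_hom (hX : IsHomogeneousSpace a q) (hY : IsHomogeneousSpace b r) :
    ∃ e : X ⟶ Y, q ≫ e = r := by
  obtain ⟨T, f, M, _, _, hf⟩ := hX.exists_lift (𝟙 X)
  rw [Category.comp_id] at hf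
  have hdesc : ∀ {Z : Scheme.{0}} (g₁ g₂ : Z ⟶ T), g₁ ≫ f = g₂ ≫ f →
      g₁ ≫ ofGL M ≫ r = g₂ ≫ ofGL M ≫ r := fun g₁ g₂ h => by
    rw [← Category.assoc, ← Category.assoc, ← hX.comp_eq_comp_iff hY, Category.assoc,
      Category.assoc, ← hf, h]
  refine ⟨EffectiveEpi.desc f (ofGL M ≫ r) hdesc, ?_⟩
  have hfac := EffectiveEpi.fac f (ofGL M ≫ r) hdesc
  -- The identity `q ≫ e = r` is tested on the étale cover `T ×_X GL_n` of `GL_n`, where both the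
  -- lift `M` and the tautological point are available.
  have hepi : Epi (pullback.snd f q) := epi_of_etale_of_surjective _
  rw [← cancel_epi (pullback.snd f q), ← pullback.condition_assoc, hfac, ← Category.assoc,
    ← hX.comp_eq_comp_iff hY, Category.assoc, ← hf, pullback.condition]

/-- A morphism from a homogeneous space is determined by its composition with the quotient
morphism. -/
lemma hom_ext (hX : IsHomogeneousSpace a q) {Z : Scheme.{0}} {e e' : X ⟶ Z}
    (h : q ≫ e = q ≫ e') : e = e' := by
  obtain ⟨T, f, M, _, _, hf⟩ := hX.exists_lift (𝟙 X)
  rw [Category.comp_id] at hf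
  have hepi : Epi f := epi_of_etale_of_surjective _
  rw [← cancel_epi f, hf, Category.assoc, Category.assoc, h]

/-- Two homogeneous spaces `GL_n / S_n` are isomorphic. -/
lemma exists_iso (hX : IsHomogeneousSpace a q) (hY : IsHomogeneousSpace b r) :
    ∃ e : X ≅ Y, q ≫ e.hom = r ∧ ∀ (T : Scheme.{0}) (M : GL (Fin n) Γ(T, ⊤)) (x : T ⟶ X),
      a.smul M x ≫ e.hom = b.smul M (x ≫ e.hom) := by
  obtain ⟨e, he⟩ := hX.exists_hom hY
  obtain ⟨e', he'⟩ := hY.exists_hom hX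
  refine ⟨⟨e, e', hX.hom_ext ?_, hY.hom_ext ?_⟩, he, fun T M x => ?_⟩
  · rw [← Category.assoc, he, he', Category.comp_id]
  · rw [← Category.assoc, he', he, Category.comp_id]
  -- Equivariance may be checked étale-locally, where `x` comes from a matrix `N` and both quotient
  -- morphisms are equivariant.
  · obtain ⟨T', f, N, _, _, hf⟩ := hX.exists_lift x
    have hepi : Epi f := epi_of_etale_of_surjective _
    rw [← cancel_epi f, ← Category.assoc, a.comp_smul, b.comp_smul, hf, ← hX.equivariant,
      reassoc_of% hf]
    change (ofGL _ ≫ q) ≫ e = b.smul _ (ofGL N ≫ q ≫ e)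
    rw [he, ← hY.equivariant, Category.assoc, he]

end IsHomogeneousSpace

/-! ### The étale locus is a homogeneous space -/

lemma homSpecEquiv_comp_SpecMap {R S : CommRingCat.{u}} {T : Scheme.{u}} (f : T ⟶ Spec S)
    (φ : R ⟶ S) : homSpecEquiv R T (f ≫ Spec.map φ) = (homSpecEquiv S T f).comp φ.hom := by
  apply (homSpecEquiv R T).symm.injective
  rw [Equiv.symm_apply_apply]
  obtain ⟨g, rfl⟩ := (homSpecEquiv S T).symm.surjective f
  rw [Equiv.apply_symm_apply]
  change (T.toSpecΓ ≫ Spec.map (CommRingCat.ofHom g)) ≫ Spec.map φ =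
    T.toSpecΓ ≫ Spec.map (CommRingCat.ofHom (g.comp φ.hom))
  rw [Category.assoc, ← Spec.map_comp]
  rfl

lemma ofAlg_injective {T : Scheme.{0}} :
    Function.Injective (ofAlg : BasedAlg n Γ(T, ⊤) → (T ⟶ moduli n)) :=
  (moduliRep n).homEquiv.symm.injective

lemma orbitMap_comp_ι (n : ℕ) : orbitMap n ≫ (etaleLocus n).ι =
    ofAlg ((split n Γ(GLScheme n, ⊤)).smul (toGL (𝟙 (GLScheme n)))) :=
  IsOpenImmersion.lift_fac _ _ _

lemma ofGL_comp_orbitMap {T : Scheme.{0}} (M : GL (Fin n) Γ(T, ⊤)) :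
    ofGL M ≫ orbitMap n ≫ (etaleLocus n).ι = ofAlg ((split n Γ(T, ⊤)).smul M) := by
  rw [orbitMap_comp_ι]
  apply (moduliRep n).homEquiv.injective
  change toAlg _ = toAlg _
  rw [toAlg_comp, toAlg_ofAlg, toAlg_ofAlg, BasedAlg.map_smul, map_split]
  congr 1
  rw [← toGL_comp, Category.comp_id, toGL_ofGL]

lemma orbitMap_comp_ι_eq_SpecMap (n : ℕ) : orbitMap n ≫ (etaleLocus n).ι =
    Spec.map (CommRingCat.ofHom (orbitHom n)) := by
  rw [orbitMap_comp_ι]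
  apply (homSpecEquiv (.of (CoordRing n)) (GLScheme n)).injective
  have h1 := homSpecEquiv_comp_SpecMap (R := .of (CoordRing n)) (𝟙 (Spec (.of (GLRing n))))
    (CommRingCat.ofHom (orbitHom n))
  rw [Category.id_comp] at h1
  refine Eq.trans ?_ h1.symm
  refine Eq.trans ?_ (comp_orbitHom _).symm
  exact (Equiv.apply_symm_apply (homSpecEquiv (.of (CoordRing n)) (GLScheme n)) _)

instance (n : ℕ) : Etale (orbitMap n) := by
  have : Etale (orbitMap n ≫ (etaleLocus n).ι) := by
    rw [orbitMap_comp_ι_eq_SpecMap]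
    exact (HasRingHomProperty.Spec_iff (P := @Etale)).2 (etale_orbitHom n)
  exact Etale.of_comp _ (etaleLocus n).ι

instance (n : ℕ) : Surjective (orbitMap n) := by
  refine ⟨fun y => ?_⟩
  obtain ⟨x, hx⟩ := (range_comap_orbitHom n).ge y.2
  refine ⟨x, (etaleLocus n).ι.isOpenEmbedding.injective ?_⟩
  refine (Scheme.Hom.comp_apply (orbitMap n) (etaleLocus n).ι x).symm.trans ?_
  rw [orbitMap_comp_ι_eq_SpecMap]
  exact hx

lemma toGL_comp_SnToGL {T : Scheme.{0}} (s : T ⟶ SnScheme n) : toGL (s ≫ SnToGL n) =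
    Matrix.GeneralLinearGroup.map (homSpecEquiv (.of (Equiv.Perm (Fin n) → ℤ)) T s)
      (univPerm n) := by
  have h : homSpecEquiv (.of (GLRing n)) T (s ≫ SnToGL n) =
      (homSpecEquiv (.of (Equiv.Perm (Fin n) → ℤ)) T s).comp (glHom (univPerm n)) :=
    homSpecEquiv_comp_SpecMap (S := .of (Equiv.Perm (Fin n) → ℤ)) s _
  change Matrix.GeneralLinearGroup.map (homSpecEquiv (.of (GLRing n)) T (s ≫ SnToGL n))
    (univGL n) = _
  rw [h]
  conv_rhs => rw [← map_glHom_univGL (univPerm n)]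
  rfl

theorem isHomogeneousSpace_etaleLocus (n : ℕ) :
    IsHomogeneousSpace (etaleAction n) (orbitMap n) where
  equivariant M N := by
    have h : (etaleAction n).smul M (ofGL N ≫ orbitMap n) ≫ (etaleLocus n).ι =
        (moduliAction n).smul M ((ofGL N ≫ orbitMap n) ≫ (etaleLocus n).ι) :=
      IsOpenImmersion.lift_fac _ _ _
    rw [← cancel_mono (etaleLocus n).ι, h, Category.assoc, Category.assoc, ofGL_comp_orbitMap,
      ofGL_comp_orbitMap, BasedAlg.mul_smul]
    change _ = ofAlg ((toAlg (ofAlg _)).smul M)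
    rw [toAlg_ofAlg]
  eq_iff {T} M N := by
    rw [← cancel_mono (etaleLocus n).ι, Category.assoc, Category.assoc, ofGL_comp_orbitMap,
      ofGL_comp_orbitMap, ofAlg_injective.eq_iff, smul_split_eq_smul_split_iff]
    rw [← (homSpecEquiv (.of (Equiv.Perm (Fin n) → ℤ)) T).exists_congr_right]
    exact exists_congr fun s => iff_of_eq (congrArg (N = M * ·) (toGL_comp_SnToGL s).symm)
  exists_lift {T} x := by
    -- The cover is the pullback of the orbit map along `x`, and the lift is its tautological
    -- projection to `GL_n`.
    obtain ⟨M, hM⟩ := exists_eq_ofGL (pullback.snd x (orbitMap n))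
    exact ⟨_, pullback.fst x (orbitMap n), M, inferInstance, inferInstance, by
      rw [pullback.condition, hM]⟩

end

end BasedAlgebras

namespace BasedAlgebras

noncomputable section

/-! ### Dimension theory -/

/-- An integral ring homomorphism that is surjective on spectra preserves the Krull dimension. -/
lemma ringKrullDim_eq_of_isIntegral {R S : Type*} [CommRing R] [CommRing S] (f : R →+* S)
    (hf : f.IsIntegral) (hs : Function.Surjective (PrimeSpectrum.comap f)) :
    ringKrullDim R = ringKrullDim S := by
  algebraize [f]
  have : Algebra.IsIntegral R S := ⟨hf⟩
  refine le_antisymm ?_ ?_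
  · refine iSup_le fun l => ?_
    obtain ⟨P, hP⟩ := hs l.head
    have : P.asIdeal.LiesOver l.head.asIdeal := ⟨by rw [← hP]; rfl⟩
    -- Going up lifts the whole chain once its smallest prime is lifted; the reverse inequality
    -- below is incomparability.
    obtain ⟨L, hL, -⟩ := Ideal.exists_ltSeries_of_hasGoingUp (S := S) l P.asIdeal
    rw [← hL]
    exact le_iSup (fun l : LTSeries (PrimeSpectrum S) => ((l.length : ℕ∞) : WithBot ℕ∞)) L
  · exact Order.krullDim_le_of_strictMono (PrimeSpectrum.comap f) fun I J h =>
      Ideal.IsIntegral.comap_lt_comap (R := R) h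

/-- The Krull dimension of a finitely generated domain over a field is its transcendence degree. -/
lemma exists_ringKrullDim_eq_trdeg (k A : Type u) [Field k] [CommRing A] [IsDomain A] [Algebra k A]
    [Algebra.FiniteType k A] :
    ∃ s : ℕ, ringKrullDim A = s ∧ Algebra.trdeg k A = s := by
  -- By Noether normalization `A` is integral over a polynomial ring in `s` variables, and both
  -- invariants are unchanged by this extension.
  obtain ⟨s, g, hg, hint⟩ := exists_integral_inj_algHom_of_fg k A
  refine ⟨s, ?_, ?_⟩
  · rw [← ringKrullDim_eq_of_isIntegral g.toRingHom hint
      (RingHom.IsIntegral.comap_surjective hint hg)]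
    simp
  · algebraize [g.toRingHom]
    have : FaithfulSMul (MvPolynomial (Fin s) k) A :=
      (faithfulSMul_iff_algebraMap_injective _ _).2 hg
    have : IsScalarTower k (MvPolynomial (Fin s) k) A :=
      .of_algebraMap_eq' g.comp_algebraMap.symm
    rw [← trdeg_add_eq k (MvPolynomial (Fin s) k) (A := A), trdeg_eq_zero (R := MvPolynomial (Fin s) k), add_zero,
      MvPolynomial.trdeg_of_isDomain]
    simp

lemma topologicalKrullDim_eq_of_isEmbedding {X Y : Type*} [TopologicalSpace X]
    [TopologicalSpace Y] {f : X → Y} (hf : Topology.IsEmbedding f) {s : Set Y}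
    (hs : Set.range f = s) : topologicalKrullDim s = topologicalKrullDim X := by
  subst hs
  exact (IsHomeomorph.topologicalKrullDim_eq _ hf.toHomeomorph.isHomeomorph).symm

/-- The closure of an irreducible open subset is an irreducible component. -/
lemma closure_mem_irreducibleComponents {X : Type*} [TopologicalSpace X] {U : Set X}
    (hU : IsOpen U) (hU' : IsIrreducible U) : closure U ∈ irreducibleComponents X := by
  refine ⟨hU'.closure, fun Z hZ h => ?_⟩
  have hne : (Z ∩ U).Nonempty :=
    hU'.nonempty.mono fun x hx => ⟨h (subset_closure hx), hx⟩
  exact (subset_closure_inter_of_isPreirreducible_of_isOpen hZ.2 hU hne).trans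
    (closure_mono Set.inter_subset_right)

/-! ### The ring of functions on `GL_n` is integral over that of the étale locus -/

open BasedAlg

variable {n : ℕ}

instance (n : ℕ) : IsDomain (GLRing n) :=
  IsLocalization.isDomain_localization
    (powers_le_nonZeroDivisors_of_noZeroDivisors (Matrix.det_mvPolynomialX_ne_zero (Fin n) ℤ))

/-- The inverse of the universal invertible matrix. -/
abbrev univInv (n : ℕ) : Matrix (Fin n) (Fin n) (GLRing n) := ((univGL n)⁻¹ : GL (Fin n) _).1

/-- Over `GL_n`, the inverse universal matrix maps the universal algebra to the split one. Its row
`j` is the composite with the `j`-th projection, a character; this is its multiplicativity on basis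
vectors. -/
lemma univInv_mul_univInv (j i l : Fin n) : univInv n j i * univInv n j l =
    ∑ m, orbitHom n ((univAlg n).c i l m) * univInv n j m := by
  have hA : ∀ x y, univInv n *ᵥ (((univAlg n).map (orbitHom n)).mul x y) =
      (univInv n *ᵥ x) * (univInv n *ᵥ y) := fun x y => by
    rw [orbitHom, univAlg_map_algHom, smul_mul, split_mul, Matrix.mulVec_mulVec, ← Units.val_mul,
      inv_mul_cancel]
    simp
  have h := congrFun (hA (e n _ i) (e n _ l)) j
  rw [mul_e] at h
  have he : ∀ i j, (univInv n *ᵥ e n _ i) j = univInv n j i := fun i j => by simp [e]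
  rw [Pi.mul_apply, he, he] at h
  rw [← h]
  change ∑ m, univInv n j m * orbitHom n _ = ∑ m, orbitHom n _ * univInv n j m
  exact Finset.sum_congr rfl fun m _ => mul_comm _ _

lemma sum_univInv (j : Fin n) :
    ∑ m, orbitHom n ((univAlg n).d m) * univInv n j m = 1 := by
  have hA : univInv n *ᵥ ((univAlg n).map (orbitHom n)).d = 1 := by
    rw [orbitHom, univAlg_map_algHom]
    change univInv n *ᵥ ((univGL n).1 *ᵥ (split n _).d) = 1
    rw [Matrix.mulVec_mulVec, ← Units.val_mul, inv_mul_cancel, split_d]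
    simp
  refine Eq.trans ?_ (congrFun hA j)
  exact Finset.sum_congr rfl fun m _ => mul_comm (orbitHom n _) (univInv n j m)

/-- The values of a character on a basis span a finitely generated module stable under
multiplication by each of them, so they are integral. The module is nonzero because it contains the
value `1` at the unit. -/
lemma isIntegralElem_univInv (j i : Fin n) : (orbitHom n).IsIntegralElem (univInv n j i) := by
  algebraize [orbitHom n]
  change IsIntegral (CoordRing n) (univInv n j i)
  let N : Submodule (CoordRing n) (GLRing n) :=
    Submodule.span _ (Set.range fun m => univInv n j m)
  have hmem : ∀ m, univInv n j m ∈ N := fun m => Submodule.subset_span ⟨m, rfl⟩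
  have hsum : ∀ a : Fin n → CoordRing n, ∑ m, orbitHom n (a m) * univInv n j m ∈ N := fun a =>
    N.sum_mem fun m _ => N.smul_mem (a m) (hmem m)
  have h1 : (1 : GLRing n) ∈ N := by
    rw [← sum_univInv j]
    exact hsum _
  refine isIntegral_of_smul_mem_submodule N (fun h => ?_)
    (Submodule.fg_span (Set.finite_range _)) _ fun x hx => ?_
  · rw [h, Submodule.mem_bot] at h1
    exact one_ne_zero h1
  · rw [smul_eq_mul]
    induction hx using Submodule.span_induction with
    | mem x hx =>
      obtain ⟨l, rfl⟩ := hx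
      rw [univInv_mul_univInv]
      exact hsum _
    | zero => rw [mul_zero]; exact N.zero_mem
    | add x y _ _ hx hy => rw [mul_add]; exact N.add_mem hx hy
    | smul a x _ hx => rw [mul_smul_comm]; exact N.smul_mem a hx

/-- The coordinate ring of the étale locus. -/
abbrev EtaleRing (n : ℕ) : Type := Localization.Away (discFun n)

/-- The ring homomorphism corresponding to the morphism from `GL_n` to the étale locus. -/
def etaleOrbitHom (n : ℕ) : EtaleRing n →+* GLRing n :=
  IsLocalization.Away.lift (discFun n) (isUnit_orbitHom_discFun n)

lemma etaleOrbitHom_algebraMap (x : CoordRing n) :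
    etaleOrbitHom n (algebraMap _ _ x) = orbitHom n x :=
  IsLocalization.Away.lift_eq _ _ _

lemma isIntegral_etaleOrbitHom (n : ℕ) : (etaleOrbitHom n).IsIntegral := by
  have hinv : ∀ i j, (etaleOrbitHom n).IsIntegralElem (univInv n i j) := fun i j => by
    obtain ⟨p, hp, h⟩ := isIntegralElem_univInv i j
    refine ⟨p.map (algebraMap _ _), hp.map _, ?_⟩
    rw [Polynomial.eval₂_map]
    rwa [show (etaleOrbitHom n).comp (algebraMap _ _) = orbitHom n from
      RingHom.ext etaleOrbitHom_algebraMap]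
  algebraize [etaleOrbitHom n]
  have hdet : IsIntegral (EtaleRing n) (univInv n).det := IsIntegral.det hinv
  have hadj : ∀ i j, IsIntegral (EtaleRing n) ((univInv n).adjugate i j) := fun i j => by
    rw [Matrix.adjugate_apply]
    refine IsIntegral.det fun a b => ?_
    rw [Matrix.updateRow_apply]
    split_ifs
    · rw [Pi.single_apply]
      split_ifs
      · exact isIntegral_one
      · exact isIntegral_zero
    · exact hinv a b
  have hmul : (univGL n).1 * univInv n = 1 := by
    rw [← Units.val_mul, mul_inv_cancel, Units.val_one]
  have hX : ∀ i j, IsIntegral (EtaleRing n) ((univGL n).1 i j) := fun i j => by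
    have h1 : (univGL n).1 i j * (univInv n).det = (univInv n).adjugate i j := by
      have : (univInv n).det • (univGL n).1 = (univInv n).adjugate := by
        calc (univInv n).det • (univGL n).1
            = (univGL n).1 * (univInv n * (univInv n).adjugate) := by
              rw [Matrix.mul_adjugate]; simp
          _ = _ := by rw [← mul_assoc, hmul, _root_.one_mul]
      rw [← this, Matrix.smul_apply, smul_eq_mul, mul_comm]
    -- Cramer's rule recovers the matrix from its inverse up to the factor `det`, and the square of
    -- that factor is the discriminant, invertible on the étale locus.
    have h2 : (univGL n).1 i j = algebraMap (EtaleRing n) (GLRing n)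
        (IsLocalization.Away.invSelf (discFun n)) *
          ((univInv n).adjugate i j * (univInv n).det) := by
      rw [← h1, mul_assoc, ← pow_two, ← orbitHom_discFun, mul_comm, mul_assoc,
        ← etaleOrbitHom_algebraMap]
      change _ = _ * (etaleOrbitHom n _ * etaleOrbitHom n _)
      rw [← map_mul, IsLocalization.Away.mul_invSelf, map_one, mul_one]
    rw [h2]
    exact isIntegral_algebraMap.mul ((hadj i j).mul hdet)
  have hpoly : ∀ p : MvPolynomial (Fin n × Fin n) ℤ,
      IsIntegral (EtaleRing n) (algebraMap _ (GLRing n) p) := fun p => by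
    induction p using MvPolynomial.induction_on with
    | C a =>
      have : algebraMap (MvPolynomial (Fin n × Fin n) ℤ) (GLRing n) (MvPolynomial.C a) =
        algebraMap (EtaleRing n) (GLRing n) (a : EtaleRing n) := by simp
      rw [this]
      exact isIntegral_algebraMap
    | add p q hp hq => rw [map_add]; exact hp.add hq
    | mul_X p i hp => rw [map_mul]; exact hp.mul (hX i.1 i.2)
  intro z
  obtain ⟨m, p, hp⟩ := IsLocalization.Away.surj
    (Matrix.mvPolynomialX (Fin n) (Fin n) ℤ).det z
  -- The denominators in `GLRing n` are powers of the universal determinant, whose inverse is the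
  -- integral element `(univInv n).det`.
  have hdet' : algebraMap _ (GLRing n) (Matrix.mvPolynomialX (Fin n) (Fin n) ℤ).det *
      (univInv n).det = 1 := by
    rw [RingHom.map_det]
    change (univGL n).1.det * _ = 1
    rw [← Matrix.det_mul, hmul, Matrix.det_one]
  have hz : z = algebraMap _ (GLRing n) p * (univInv n).det ^ m := by
    rw [← hp, mul_assoc, ← mul_pow, hdet', one_pow, mul_one]
  rw [hz]
  exact (hpoly p).mul (hdet.pow m)

end

end BasedAlgebras

namespace BasedAlgebras

noncomputable section

/-! ### Base change of localizations of polynomial rings to a field -/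

section PolynomialLocalization

variable (k : Type u) [Field k] {σ : Type} (f : MvPolynomial σ ℤ)

instance : IsDomain (k ⊗[ℤ] MvPolynomial σ ℤ) :=
  (MvPolynomial.algebraTensorAlgEquiv (σ := σ) ℤ k).toMulEquiv.isDomain _

lemma powers_one_tmul_le (hf : f.map (Int.castRingHom k) ≠ 0) :
    Submonoid.powers ((1 : k) ⊗ₜ[ℤ] f) ≤ nonZeroDivisors _ := by
  refine powers_le_nonZeroDivisors_of_noZeroDivisors fun h => hf ?_
  have h1 := congrArg (MvPolynomial.algebraTensorAlgEquiv (σ := σ) ℤ k) h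
  rwa [map_zero, MvPolynomial.algebraTensorAlgEquiv_tmul, one_smul] at h1

variable (B : Type) [CommRing B] [Algebra (MvPolynomial σ ℤ) B] [IsLocalization.Away f B]

/-- The base change of a localization of a polynomial ring is a localization. -/
def tensorLocalizationEquiv : (k ⊗[ℤ] B) ≃ₐ[k] Localization.Away ((1 : k) ⊗ₜ[ℤ] f) :=
  have := IsScalarTower.of_algebraMap_eq' (R := ℤ) (S := MvPolynomial σ ℤ) (A := B)
    (Subsingleton.elim _ _)
  IsLocalization.Away.tensorProductEquivTMulRight ℤ k f B

variable {f}

lemma isDomain_tensor_of_isLocalization (hf : f.map (Int.castRingHom k) ≠ 0) :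
    IsDomain (k ⊗[ℤ] B) :=
  have : IsDomain (Localization.Away ((1 : k) ⊗ₜ[ℤ] f)) :=
    IsLocalization.isDomain_localization (powers_one_tmul_le k f hf)
  (tensorLocalizationEquiv k f B).toMulEquiv.isDomain _

/-- After base change the ring is a localization of a polynomial ring over `k` at a nonzero element,
which is an algebraic extension. -/
lemma trdeg_tensor_of_isLocalization [Finite σ] (hf : f.map (Int.castRingHom k) ≠ 0) :
    Algebra.trdeg k (k ⊗[ℤ] B) = Nat.card σ := by
  rw [(tensorLocalizationEquiv k f B).trdeg_eq]
  set P := k ⊗[ℤ] MvPolynomial σ ℤ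
  set L := Localization.Away ((1 : k) ⊗ₜ[ℤ] f)
  have : IsDomain L := IsLocalization.isDomain_localization (powers_one_tmul_le k f hf)
  have : FaithfulSMul P L := (faithfulSMul_iff_algebraMap_injective _ _).2
    (IsLocalization.injective _ (powers_one_tmul_le k f hf))
  have : Algebra.IsAlgebraic P L :=
    IsLocalization.isAlgebraic L (Submonoid.powers ((1 : k) ⊗ₜ[ℤ] f))
  rw [← trdeg_add_eq k P (A := L), trdeg_eq_zero (R := P), add_zero,
    (MvPolynomial.algebraTensorAlgEquiv (σ := σ) ℤ k).trdeg_eq,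
    MvPolynomial.trdeg_of_isDomain, ← Nat.cast_card, Cardinal.lift_natCast]

end PolynomialLocalization

/-! ### Base change of an integral covering of an open subscheme to a field -/

section Fiber

variable (k : Type u) [Field k] {A B L : Type} [CommRing A] [CommRing B] [CommRing L]
  [Algebra A L] (φ : A →+* B) (ψ : L →+* B) (d : A)

/-- The base change of a ring homomorphism to a field. -/
def tensorHom : (k ⊗[ℤ] A) →ₐ[k] (k ⊗[ℤ] B) :=
  Algebra.TensorProduct.map (AlgHom.id k k) φ.toIntAlgHom

@[simp]
lemma tensorHom_tmul (a : k) (x : A) : tensorHom k φ (a ⊗ₜ x) = a ⊗ₜ φ x := by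
  simp [tensorHom]

/-- A pure tensor is a scalar from `k` times `1 ⊗ b`, and `1 ⊗ b` satisfies the monic equation of
`b`. -/
lemma isIntegral_tensorHom (hφ : φ.IsIntegral) : (tensorHom k φ).IsIntegral := by
  intro z
  induction z using TensorProduct.induction_on with
  | zero => exact RingHom.isIntegralElem_zero _
  | add x y hx hy => exact RingHom.IsIntegralElem.add _ hx hy
  | tmul a b =>
    have h : a ⊗ₜ[ℤ] b = (tensorHom k φ).toRingHom (a ⊗ₜ 1) * (1 : k) ⊗ₜ[ℤ] b := by
      change _ = tensorHom k φ (a ⊗ₜ 1) * _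
      simp
    rw [h]
    refine RingHom.IsIntegralElem.mul _ (RingHom.isIntegralElem_map _) ?_
    obtain ⟨p, hp, hb⟩ := hφ b
    refine ⟨p.map (Algebra.TensorProduct.includeRight (R := ℤ) (A := k)).toRingHom, hp.map _, ?_⟩
    have h1 := Polynomial.hom_eval₂ p φ
      (Algebra.TensorProduct.includeRight (R := ℤ) (A := k) (B := B)).toRingHom b
    rw [hb, map_zero] at h1
    rw [Polynomial.eval₂_map]
    refine Eq.trans ?_ h1.symm
    congr 1

variable {φ d}

/-- A geometric point of `k ⊗ A` restricts to one of `A`; its lift to `B`, recombined with the given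
map on `k`, is a geometric point of `k ⊗ B`. -/
lemma range_comap_tensorHom (hd : IsUnit (φ d))
    (hφ : ∀ (K : Type u) [Field K] [IsAlgClosed K] (f : A →+* K), f d ≠ 0 →
      ∃ g : B →+* K, g.comp φ = f) :
    Set.range (PrimeSpectrum.comap (tensorHom k φ).toRingHom) =
      PrimeSpectrum.basicOpen ((1 : k) ⊗ₜ[ℤ] d) := by
  have h1 : (tensorHom k φ).toRingHom (1 ⊗ₜ d) =
      Algebra.TensorProduct.includeRight (R := ℤ) (φ d) := tensorHom_tmul k φ 1 d
  refine range_comap_eq_basicOpen (h1.symm ▸ hd.map _) fun K _ _ f hf => ?_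
  obtain ⟨g₀, hg₀⟩ := hφ K
    (f.comp (Algebra.TensorProduct.includeRight (R := ℤ) (A := k)).toRingHom) hf
  let g : k ⊗[ℤ] B →ₐ[ℤ] K := Algebra.TensorProduct.lift
    (f.comp Algebra.TensorProduct.includeLeftRingHom).toIntAlgHom g₀.toIntAlgHom
    fun _ _ => Commute.all _ _
  refine ⟨g.toRingHom, Algebra.TensorProduct.ringHom_ext ?_ ?_⟩
  · ext a
    change g (tensorHom k φ (a ⊗ₜ 1)) = f (a ⊗ₜ 1)
    simp [g]
  · ext x
    change g (tensorHom k φ (1 ⊗ₜ x)) = (f.comp (RingHomClass.toRingHom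
      (Algebra.TensorProduct.includeRight (R := ℤ) (A := k)))) x
    refine Eq.trans ?_ (congrArg (fun h : A →+* K => h x) hg₀)
    simp [g, ← Algebra.TensorProduct.one_def]

variable {ψ} {m : ℕ}

lemma isIrreducible_basicOpen_tmul [IsDomain (k ⊗[ℤ] B)]
    (hr : Set.range (PrimeSpectrum.comap (tensorHom k φ).toRingHom) =
      PrimeSpectrum.basicOpen ((1 : k) ⊗ₜ[ℤ] d)) :
    IsIrreducible (PrimeSpectrum.basicOpen ((1 : k) ⊗ₜ[ℤ] d) : Set (PrimeSpectrum (k ⊗[ℤ] A))) := by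
  have h := (IrreducibleSpace.isIrreducible_univ (PrimeSpectrum (k ⊗[ℤ] B))).image
    (PrimeSpectrum.comap (tensorHom k φ).toRingHom)
    (PrimeSpectrum.continuous_comap _).continuousOn
  rwa [Set.image_univ, hr] at h

lemma ringKrullDim_tensor_eq [IsDomain (k ⊗[ℤ] B)] (hB : (Int.castRingHom B).FiniteType)
    (hdim : Algebra.trdeg k (k ⊗[ℤ] B) = m) : ringKrullDim (k ⊗[ℤ] B) = (m : WithBot ℕ∞) := by
  rw [Subsingleton.elim (Int.castRingHom B) (algebraMap ℤ B), RingHom.finiteType_algebraMap] at hB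
  obtain ⟨s, h1, h2⟩ := exists_ringKrullDim_eq_trdeg k (k ⊗[ℤ] B)
  rw [hdim, Nat.cast_inj] at h2
  rw [h1, ← h2]

lemma ringKrullDim_localization_tmul [IsLocalization.Away d L] (hψ : ψ.IsIntegral)
    (hψφ : ψ.comp (algebraMap A L) = φ)
    (hr : Set.range (PrimeSpectrum.comap (tensorHom k φ).toRingHom) =
      PrimeSpectrum.basicOpen ((1 : k) ⊗ₜ[ℤ] d)) :
    ringKrullDim (Localization.Away ((1 : k) ⊗ₜ[ℤ] d)) = ringKrullDim (k ⊗[ℤ] B) := by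
  have := IsScalarTower.of_algebraMap_eq' (R := ℤ) (S := A) (A := L) (Subsingleton.elim _ _)
  let ε : (k ⊗[ℤ] L) ≃ₐ[k] Localization.Away ((1 : k) ⊗ₜ[ℤ] d) :=
    IsLocalization.Away.tensorProductEquivTMulRight ℤ k d L
  let g : Localization.Away ((1 : k) ⊗ₜ[ℤ] d) →+* k ⊗[ℤ] B :=
    (tensorHom k ψ).toRingHom.comp ε.symm.toRingEquiv.toRingHom
  have hg : g.IsIntegral := RingHom.IsIntegral.trans _ _
    (RingHom.isIntegral_of_surjective _ ε.symm.surjective) (isIntegral_tensorHom k ψ hψ)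
  have hε : ∀ (a : k) (x : A), ε.symm (algebraMap _ _ (a ⊗ₜ[ℤ] x)) = a ⊗ₜ algebraMap A L x :=
    fun a x => by
      rw [AlgEquiv.symm_apply_eq]
      exact (IsLocalization.Away.tensorProductEquivTMulRight_tmul A d L a x).symm
  have hcomp : g.comp (algebraMap (k ⊗[ℤ] A) _) = (tensorHom k φ).toRingHom := by
    refine Algebra.TensorProduct.ringHom_ext ?_ ?_
    · ext a
      change tensorHom k ψ (ε.symm (algebraMap _ _ (a ⊗ₜ 1))) = tensorHom k φ (a ⊗ₜ 1)
      rw [hε, tensorHom_tmul, tensorHom_tmul, ← hψφ]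
      rfl
    · ext x
      change tensorHom k ψ (ε.symm (algebraMap _ _ (1 ⊗ₜ x))) = tensorHom k φ (1 ⊗ₜ x)
      rw [hε, tensorHom_tmul, tensorHom_tmul, ← hψφ]
      rfl
  refine ringKrullDim_eq_of_isIntegral g hg fun p => ?_
  -- Surjectivity on spectra: primes of the localization are the points of the basic open set, which
  -- is the image of `Spec (k ⊗ B)`.
  have hp : PrimeSpectrum.comap (algebraMap (k ⊗[ℤ] A) _) p ∈
      Set.range (PrimeSpectrum.comap (tensorHom k φ).toRingHom) := by
    rw [hr, ← PrimeSpectrum.localization_away_comap_range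
      (Localization.Away ((1 : k) ⊗ₜ[ℤ] d))]
    exact ⟨p, rfl⟩
  obtain ⟨q, hq⟩ := hp
  refine ⟨q, (PrimeSpectrum.localization_away_isOpenEmbedding _
    ((1 : k) ⊗ₜ[ℤ] d)).injective ?_⟩
  rw [← hq, ← hcomp]
  rfl

lemma topologicalKrullDim_basicOpen {R : Type*} [CommRing R] (r : R) :
    topologicalKrullDim (PrimeSpectrum.basicOpen r : Set (PrimeSpectrum R)) =
      ringKrullDim (Localization.Away r) := by
  rw [← PrimeSpectrum.topologicalKrullDim_eq_ringKrullDim]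
  exact topologicalKrullDim_eq_of_isEmbedding
    (PrimeSpectrum.localization_away_isOpenEmbedding (Localization.Away r) r).isEmbedding
    (PrimeSpectrum.localization_away_comap_range _ _)

lemma topologicalKrullDim_closure_range_comap {R S : Type*} [CommRing R] [CommRing S]
    (f : R →+* S) :
    topologicalKrullDim (closure (Set.range (PrimeSpectrum.comap f))) =
      ringKrullDim (R ⧸ RingHom.ker f) := by
  rw [← PrimeSpectrum.topologicalKrullDim_eq_ringKrullDim, PrimeSpectrum.closure_range_comap]
  refine topologicalKrullDim_eq_of_isEmbedding
    (PrimeSpectrum.isClosedEmbedding_comap_of_surjective _ (Ideal.Quotient.mk (RingHom.ker f))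
      Ideal.Quotient.mk_surjective).isEmbedding ?_
  rw [range_comap_of_surjective _ _ Ideal.Quotient.mk_surjective, Ideal.mk_ker]

/-- A dense open subset only bounds the dimension of its closure from below. The upper bound comes
from embedding `R ⧸ ker f` in `S` and comparing transcendence degrees. -/
lemma topologicalKrullDim_closure_range_comap_le {R S : Type u} [CommRing R] [CommRing S]
    [IsDomain S] [Algebra k R] [Algebra k S] [Algebra.FiniteType k R] (f : R →ₐ[k] S)
    (hdim : Algebra.trdeg k S = m) :
    topologicalKrullDim (closure (Set.range (PrimeSpectrum.comap f.toRingHom))) ≤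
      (m : WithBot ℕ∞) := by
  have : (RingHom.ker f.toRingHom).IsPrime := RingHom.ker_isPrime _
  obtain ⟨s, h1, h2⟩ := exists_ringKrullDim_eq_trdeg k (R ⧸ RingHom.ker f.toRingHom)
  have h3 := trdeg_le_of_injective (Ideal.kerLiftAlg f) (Ideal.kerLiftAlg_injective _)
  rw [hdim] at h3
  have h4 : (s : Cardinal) ≤ m := h2.symm.le.trans h3
  rw [topologicalKrullDim_closure_range_comap, h1]
  exact_mod_cast h4

/-- Let `B` be integral over the localization `L` of `A` at `d`, covering the open set where `d` is
invertible. If `B` has dimension `m` over `k`, then so have this open set and its closure. -/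
theorem isIrreducible_and_dim_basicOpen_tmul [IsDomain (k ⊗[ℤ] B)]
    [IsLocalization.Away d L] (hψ : ψ.IsIntegral)
    (hψφ : ψ.comp (algebraMap A L) = φ) (hA : (Int.castRingHom A).FiniteType)
    (hB : (Int.castRingHom B).FiniteType)
    (hdim : Algebra.trdeg k (k ⊗[ℤ] B) = m) (hd : IsUnit (φ d))
    (hφ : ∀ (K : Type u) [Field K] [IsAlgClosed K] (f : A →+* K), f d ≠ 0 →
      ∃ g : B →+* K, g.comp φ = f) :
    IsIrreducible (PrimeSpectrum.basicOpen ((1 : k) ⊗ₜ[ℤ] d) : Set (PrimeSpectrum (k ⊗[ℤ] A))) ∧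
      topologicalKrullDim (PrimeSpectrum.basicOpen ((1 : k) ⊗ₜ[ℤ] d) :
        Set (PrimeSpectrum (k ⊗[ℤ] A))) = m ∧
      topologicalKrullDim (closure (PrimeSpectrum.basicOpen ((1 : k) ⊗ₜ[ℤ] d) :
        Set (PrimeSpectrum (k ⊗[ℤ] A)))) = m := by
  have hr := range_comap_tensorHom k hd hφ
  have h1 : topologicalKrullDim (PrimeSpectrum.basicOpen ((1 : k) ⊗ₜ[ℤ] d) :
      Set (PrimeSpectrum (k ⊗[ℤ] A))) = m := by
    rw [topologicalKrullDim_basicOpen, ringKrullDim_localization_tmul k hψ hψφ hr,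
      ringKrullDim_tensor_eq k hB hdim]
  rw [Subsingleton.elim (Int.castRingHom A) (algebraMap ℤ A), RingHom.finiteType_algebraMap] at hA
  have h2 := topologicalKrullDim_closure_range_comap_le k (tensorHom k φ) hdim
  rw [hr] at h2
  refine ⟨isIrreducible_basicOpen_tmul k hr, h1, h2.antisymm ?_⟩
  rw [← h1]
  exact (Topology.IsEmbedding.inclusion subset_closure).isInducing.topologicalKrullDim_le

end Fiber

/-! ### The étale locus and its fibers -/

variable (n : ℕ)

lemma isIrreducible_etaleLocus : IsIrreducible (etaleLocus n : Set (moduli n)) := by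
  have h := (IrreducibleSpace.isIrreducible_univ (PrimeSpectrum (GLRing n))).image
    (PrimeSpectrum.comap (orbitHom n)) (PrimeSpectrum.continuous_comap _).continuousOn
  rw [Set.image_univ, range_comap_orbitHom] at h
  exact h

lemma finiteType_castRingHom_CoordRing : (Int.castRingHom (CoordRing n)).FiniteType := by
  rw [Subsingleton.elim (Int.castRingHom (CoordRing n)) (algebraMap ℤ _),
    RingHom.finiteType_algebraMap]
  infer_instance

lemma finiteType_castRingHom_GLRing : (Int.castRingHom (GLRing n)).FiniteType := by
  rw [Subsingleton.elim (Int.castRingHom (GLRing n)) ((algebraMap _ (GLRing n)).comp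
    (algebraMap ℤ (MvPolynomial (Fin n × Fin n) ℤ)))]
  exact RingHom.FiniteType.comp (RingHom.finiteType_algebraMap.2 inferInstance)
    (RingHom.finiteType_algebraMap.2 inferInstance)

/-- The generic determinant vanishes in no characteristic, so every fiber of `GL_n` is integral of
the same dimension. -/
lemma map_det_mvPolynomialX_ne_zero (k : Type u) [Field k] :
    (Matrix.mvPolynomialX (Fin n) (Fin n) ℤ).det.map (Int.castRingHom k) ≠ 0 := by
  convert Matrix.det_mvPolynomialX_ne_zero (Fin n) k
  rw [RingHom.map_det]
  congr 1
  ext i j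
  simp

lemma isIrreducible_and_dim_etaleLocusFiber (k : Type u) [Field k] :
    IsIrreducible (etaleLocusFiber n k : Set (moduliFiber n k)) ∧
      topologicalKrullDim (etaleLocusFiber n k) = ((n ^ 2 : ℕ) : WithBot ℕ∞) ∧
      topologicalKrullDim (closure (etaleLocusFiber n k : Set (moduliFiber n k))) =
        ((n ^ 2 : ℕ) : WithBot ℕ∞) := by
  have hdom := isDomain_tensor_of_isLocalization k (GLRing n) (map_det_mvPolynomialX_ne_zero n k)
  have hdim := trdeg_tensor_of_isLocalization k (GLRing n) (map_det_mvPolynomialX_ne_zero n k)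
  rw [Nat.card_prod, Nat.card_fin, ← pow_two] at hdim
  exact isIrreducible_and_dim_basicOpen_tmul k (isIntegral_etaleOrbitHom n)
    (RingHom.ext etaleOrbitHom_algebraMap) (finiteType_castRingHom_CoordRing n)
    (finiteType_castRingHom_GLRing n) hdim (isUnit_orbitHom_discFun n)
    fun K _ _ f hf => (exists_comp_orbitHom f hf).imp' _ fun _ h => h

end

end BasedAlgebras

theorem mainTheorem4 (n : ℕ) :
    BasedAlgebras.IsHomogeneousSpace (BasedAlgebras.etaleAction n) (BasedAlgebras.orbitMap n) ∧
    (∀ (X : Scheme.{0}) (a : BasedAlgebras.GLAction n X) (q : BasedAlgebras.GLScheme n ⟶ X),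
      BasedAlgebras.IsHomogeneousSpace a q →
      ∃ e : X ≅ (BasedAlgebras.etaleLocus n).toScheme,
        q ≫ e.hom = BasedAlgebras.orbitMap n ∧
        ∀ (T : Scheme.{0}) (M : GL (Fin n) Γ(T, ⊤)) (x : T ⟶ X),
          a.smul M x ≫ e.hom = (BasedAlgebras.etaleAction n).smul M (x ≫ e.hom)) ∧
    IsIrreducible (BasedAlgebras.etaleLocus n : Set (BasedAlgebras.moduli n)) ∧
    closure (BasedAlgebras.etaleLocus n : Set (BasedAlgebras.moduli n)) ∈
      irreducibleComponents (BasedAlgebras.moduli n) ∧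
    ∀ (k : Type u) [Field k],
      IsIrreducible
        (BasedAlgebras.etaleLocusFiber n k : Set (BasedAlgebras.moduliFiber n k)) ∧
      topologicalKrullDim (BasedAlgebras.etaleLocusFiber n k) = ((n ^ 2 : ℕ) : WithBot ℕ∞) ∧
      closure (BasedAlgebras.etaleLocusFiber n k : Set (BasedAlgebras.moduliFiber n k)) ∈
        irreducibleComponents (BasedAlgebras.moduliFiber n k) ∧
      topologicalKrullDim
        (closure (BasedAlgebras.etaleLocusFiber n k : Set (BasedAlgebras.moduliFiber n k))) =
        ((n ^ 2 : ℕ) : WithBot ℕ∞) :=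
  ⟨BasedAlgebras.isHomogeneousSpace_etaleLocus n,
    fun _ _ _ h => h.exists_iso (BasedAlgebras.isHomogeneousSpace_etaleLocus n),
    BasedAlgebras.isIrreducible_etaleLocus n,
    BasedAlgebras.closure_mem_irreducibleComponents (BasedAlgebras.etaleLocus n).isOpen
      (BasedAlgebras.isIrreducible_etaleLocus n),
    fun k _ =>
      have h := BasedAlgebras.isIrreducible_and_dim_etaleLocusFiber n k
      ⟨h.1, h.2.1, BasedAlgebras.closure_mem_irreducibleComponents
        (BasedAlgebras.etaleLocusFiber n k).isOpen h.1, h.2.2⟩⟩
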